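/- **Notation.** For a set $\Xi$ of primitive Dirichlet characters and an integer $q\ge 1$, let $\Xi_q$ be the (finite) set of characters mod $q$ that are induced by characters in $\Xi$. For an arithmetic function $h:\mathbb N\to\mathbb C$, a real $X$, and an integer $a$ coprime to $q$, put $$\Delta_\Xi(h,X;q,a)=\sum_{\substack{n\le X\\ n\equiv a\ (\mathrm{mod}\ q)}}h(n)-\frac1{\varphi(q)}\sum_{\chi\in\Xi_q}\chi(a)\sum_{n\le X}h(n)\overline{\chi}(n).$$ Let $f*g$ denote Dirichlet convolution. **Proposition.** Fix $D\ge 0$ and let $A=14D+28$, $B=2D+3$, $C=4D+8$. There is $x_0=x_0(D)$ such that for every $K$ there is $K'=K'(D,K)$ with the following property. Let $x\ge x_0$ be real, let $\Xi$ be any set of primitive Dirichlet characters, let $2\le Q\le \sqrt x/(\log x)^B$, and let $f,g$ be arithmetic functions (not necessarily multiplicative) such that both $h=f$ and $h=g$ satisfy: (i) $|h(n)|\le 1$ for all $n$; (ii) $|\Delta_\Xi(h,X;q,a)|\le K\,\dfrac{X}{(\log x)^A}$ for all $q\ge1$, all $a$ with $(a,q)=1$, and all $X$ with $x^{1/2}\le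 X\le x$; (iii) $\displaystyle\sum_{q\le Q}\ \max_{a:\,(a,q)=1}|\Delta_\Xi(h,X;q,a)|\le K\,\frac{X}{(\log x)^D\log\log x}$ for all $X$ with $x/(\log x)^C\le X\le x$. Then $$\sum_{q\le Q}\ \max_{a:\,(a,q)=1}|\Delta_\Xi(f*g,x;q,a)|\le K'\,\frac{x}{(\log x)^D}.$$ -/

import Mathlib

noncomputable section

/-- `Ξ` is a set of primitive Dirichlet characters (a character is recorded together with its
modulus, which is a positive integer). The trivial character mod `1` is primitive. -/
def IsPrimitiveCharSet (Ξ : Set (Σ r : ℕ, DirichletCharacter ℂ r)) : Prop :=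
  ∀ ξ ∈ Ξ, 0 < ξ.1 ∧ ξ.2.IsPrimitive

/-- `Ξ_q`: the characters mod `q` that are induced by the characters in `Ξ`. -/
def inducedChars (Ξ : Set (Σ r : ℕ, DirichletCharacter ℂ r)) (q : ℕ) :
    Set (DirichletCharacter ℂ q) :=
  {χ | ∃ ξ ∈ Ξ, ∃ h : ξ.1 ∣ q, χ = DirichletCharacter.changeLevel h ξ.2}

/-- For a positive modulus, `Ξ_q` is finite, so that the sum over it below is a genuine finite
sum. -/
theorem inducedChars_finite (Ξ : Set (Σ r : ℕ, DirichletCharacter ℂ r)) (q : ℕ) [NeZero q] :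
    (inducedChars Ξ q).Finite :=
  Set.toFinite _

/-- `S_f(x, χ) = ∑_{n ≤ x} f(n) conj(χ(n))`. -/
def charSum (f : ArithmeticFunction ℂ) (x : ℝ) {q : ℕ} (χ : DirichletCharacter ℂ q) : ℂ :=
  ∑ n ∈ Finset.Icc 1 ⌊x⌋₊, f n * (starRingEnd ℂ) (χ (n : ZMod q))

open Classical in
/-- `Δ_Ξ(f, x; q, a) = ∑_{n ≤ x, n ≡ a (mod q)} f(n) - (1 / φ(q)) ∑_{χ ∈ Ξ_q} χ(a) S_f(x, χ)`. -/
def DeltaXi (Ξ : Set (Σ r : ℕ, DirichletCharacter ℂ r)) (f : ArithmeticFunction ℂ) (x : ℝ)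
    (q : ℕ) (a : ZMod q) : ℂ :=
  (∑ n ∈ (Finset.Icc 1 ⌊x⌋₊).filter (fun n : ℕ => (n : ZMod q) = a), f n) -
    (1 / (Nat.totient q : ℂ)) * ∑ᶠ χ ∈ inducedChars Ξ q, χ a * charSum f x χ

/-- `∑_{q ≤ Q} max_{a : (a, q) = 1} |Δ_Ξ(f, x; q, a)|`, over the positive integers `q ≤ Q`.
The supremum is over the finite nonempty set of reduced residue classes mod `q`. -/
def sumMaxDelta (Ξ : Set (Σ r : ℕ, DirichletCharacter ℂ r)) (f : ArithmeticFunction ℂ) (x Q : ℝ) :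
    ℝ :=
  ∑ q ∈ Finset.Icc 1 ⌊Q⌋₊, ⨆ a : (ZMod q)ˣ, ‖DeltaXi Ξ f x q (a : ZMod q)‖

end

/-! By orthogonality, Δ_Ξ(h, X; q, a) is the sum of h(n) against a kernel, bounded by 1, built from
the characters mod q outside Ξ_q; replacing n by un with u a unit amounts to replacing a by a/u.
Write L = log x and u = L^D, and cut the pairs mn ≤ x behind f * g at M ≈ u⁴L⁸.

Small variables. For fixed m ≤ M the sum over n is bounded by max_a |Δ_Ξ(g, x/m; q, a)|, and
symmetrically for n ≤ M. Hypothesis (iii) bounds these on average over q, and ∑_{m ≤ M} 1/m = O(log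
log x) is exactly paid for by the log log x in (iii). Pairs with both variables at most M are
counted trivially.

Large variables. The pairs with m, n > M give bilinear sums twisted by characters χ outside Ξ_q.
Such a χ comes from a primitive ψ mod r outside Ξ, with q = rs and χ(n) = ψ(n) when (n, s) = 1, zero
otherwise. Since φ(r)φ(s) ≤ φ(q), the sums over r and s separate
(`sum_nonInducedChars_bilinearCharSum_le`). The modulus r is split at R ≈ uL⁴.

For r > R the multiplicative large sieve applies for each s, after dyadic cuts of m and r and a
separation of the condition mn ≤ x by binary digits (`sum_norm_bilinearCharSum_le`). The result is a
power of L times x/R + x/√M + Q√x.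

For r ≤ R, hypothesis (ii) at the modulus rk bounds the sums of conj(f)ψ and conj(g)ψ over integers
coprime to k, with a loss rφ(k) that is useless for large k (`norm_coprimeSum_le`). On average over
s the loss disappears: the condition (n, s) = 1 is expanded by Möbius, divisors d ≤ z are treated by
(ii) and divisors d > z trivially (`sum_norm_coprimeSum_le`). The hyperbola method then reaches the
bilinear sum using only sums of length at least √x, the range covered by (ii). -/

open Finset

/-! ### The additive large sieve -/

/-- The exponential sum `∑_{u < n} e(u θ)`. -/
noncomputable def expSum (n : ℕ) (θ : ℝ) : ℂ :=
  ∑ u ∈ range n, Complex.exp (Complex.I * ((2 * Real.pi * θ * u : ℝ) : ℂ))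

theorem norm_expSum_le (n : ℕ) (θ : ℝ) : ‖expSum n θ‖ ≤ n := by
  refine (norm_sum_le _ _).trans ?_
  simp only [Complex.norm_exp_I_mul_ofReal, sum_const, card_range, nsmul_eq_mul, mul_one, le_refl]

theorem exp_two_pi_sub_intCast (θ : ℝ) (k : ℤ) (u : ℤ) :
    Complex.exp (Complex.I * ((2 * Real.pi * (θ - k) * u : ℝ) : ℂ)) =
      Complex.exp (Complex.I * ((2 * Real.pi * θ * u : ℝ) : ℂ)) := by
  rw [Complex.exp_eq_exp_iff_exists_int]
  refine ⟨-(k * u), ?_⟩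
  push_cast
  ring

theorem expSum_sub_intCast (n : ℕ) (θ : ℝ) (k : ℤ) : expSum n (θ - k) = expSum n θ := by
  refine sum_congr rfl fun u _ => ?_
  have := exp_two_pi_sub_intCast θ k (u : ℤ)
  push_cast at this ⊢
  exact this

theorem norm_expSum_mul_sin_le (n : ℕ) (θ : ℝ) :
    ‖expSum n θ‖ * (2 * |Real.sin (Real.pi * θ)|) ≤ 2 := by
  have h1 : expSum n θ = ∑ u ∈ range n,
      Complex.exp (Complex.I * ((2 * Real.pi * θ : ℝ) : ℂ)) ^ u := by
    refine sum_congr rfl fun u _ => ?_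
    rw [← Complex.exp_nat_mul]
    congr 1
    push_cast
    ring
  have h2 : ‖Complex.exp (Complex.I * ((2 * Real.pi * θ : ℝ) : ℂ)) - 1‖ =
      2 * |Real.sin (Real.pi * θ)| := by
    rw [Complex.norm_exp_I_mul_ofReal_sub_one, norm_mul, Real.norm_eq_abs, Real.norm_eq_abs,
      abs_of_pos (two_pos), show 2 * Real.pi * θ / 2 = Real.pi * θ by ring]
  rw [← h2, ← norm_mul, h1, geom_sum_mul]
  refine (norm_sub_le _ _).trans ?_
  rw [norm_pow, Complex.norm_exp_I_mul_ofReal]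
  norm_num

theorem norm_expSum_mul_le {n : ℕ} {θ : ℝ} (h0 : 0 ≤ θ) (h1 : θ ≤ 1 / 2) :
    ‖expSum n θ‖ * (2 * θ) ≤ 1 := by
  have h := norm_expSum_mul_sin_le n θ
  have h2 : 2 * θ ≤ |Real.sin (Real.pi * θ)| := by
    have := Real.mul_le_sin (x := Real.pi * θ) (by positivity)
      (by nlinarith [Real.pi_pos])
    refine le_trans (le_of_eq ?_) (this.trans (le_abs_self _))
    field_simp
  nlinarith [norm_nonneg (expSum n θ)]

theorem norm_expSum_neg (n : ℕ) (θ : ℝ) : ‖expSum n (-θ)‖ = ‖expSum n θ‖ := by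
  have : expSum n (-θ) = (starRingEnd ℂ) (expSum n θ) := by
    simp only [expSum, map_sum, ← Complex.exp_conj, map_mul, Complex.conj_I, Complex.conj_ofReal]
    refine sum_congr rfl fun u _ => ?_
    congr 1
    push_cast
    ring
  rw [this, RCLike.norm_conj]

/-- A majorant of `|∑_{u < 2N} e(u θ)|²` on `k / K ≤ θ < (k + 1) / K`. -/
noncomputable def fejerMajorant (N K k : ℕ) : ℝ :=
  if k = 0 then 4 * (N : ℝ) ^ 2 else (K : ℝ) ^ 2 / (4 * (k : ℝ) ^ 2)

theorem fejerMajorant_nonneg (N K k : ℕ) : 0 ≤ fejerMajorant N K k := by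
  unfold fejerMajorant; split_ifs <;> positivity

theorem sum_inv_sq_range_le (n : ℕ) : ∑ k ∈ range n, 1 / ((k : ℝ) + 1) ^ 2 ≤ 2 := by
  have : ∀ n : ℕ, ∑ k ∈ range (n + 1), 1 / ((k : ℝ) + 1) ^ 2 ≤ 2 - 1 / ((n : ℝ) + 1) := by
    intro n
    induction n with
    | zero => norm_num
    | succ n ih =>
      rw [sum_range_succ]
      have h1 : (1 : ℝ) / (n + 1) - 1 / (n + 1 + 1) - 1 / ((n : ℝ) + 1 + 1) ^ 2 =
          1 / ((n + 1) * (n + 1 + 1) ^ 2) := by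
        field_simp; ring
      have h2 : (0 : ℝ) ≤ 1 / ((n + 1) * (n + 1 + 1) ^ 2) := by positivity
      push_cast
      linarith
  cases n with
  | zero => norm_num
  | succ n => exact (this n).trans (sub_le_self _ (by positivity))

theorem sum_fejerMajorant_le (N K n : ℕ) :
    ∑ k ∈ range n, fejerMajorant N K k ≤ 4 * (N : ℝ) ^ 2 + (K : ℝ) ^ 2 / 2 := by
  cases n with
  | zero => simp; positivity
  | succ n =>
    rw [sum_range_succ', add_comm]
    have h : ∑ k ∈ range n, fejerMajorant N K (k + 1) ≤ (K : ℝ) ^ 2 / 2 := by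
      calc _ = (K : ℝ) ^ 2 / 4 * ∑ k ∈ range n, 1 / ((k : ℝ) + 1) ^ 2 := by
            rw [mul_sum]
            refine sum_congr rfl fun k _ => ?_
            simp only [fejerMajorant, Nat.add_eq_zero_iff, one_ne_zero, and_false, if_false]
            push_cast
            field_simp
        _ ≤ (K : ℝ) ^ 2 / 4 * 2 := by gcongr; exact sum_inv_sq_range_le n
        _ = _ := by ring
    simpa [fejerMajorant] using h

theorem norm_expSum_sq_le_fejerMajorant {N K : ℕ} (hK : 0 < K) {θ : ℝ} (h0 : 0 ≤ θ)
    (h1 : θ ≤ 1 / 2) : ‖expSum (2 * N) θ‖ ^ 2 ≤ fejerMajorant N K ⌊K * θ⌋₊ := by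
  unfold fejerMajorant
  split_ifs with hk
  · have := norm_expSum_le (2 * N) θ
    push_cast at this
    nlinarith [norm_nonneg (expSum (2 * N) θ)]
  · have hk' : (0 : ℝ) < ⌊K * θ⌋₊ := by exact_mod_cast Nat.pos_of_ne_zero hk
    have hle : (⌊K * θ⌋₊ : ℝ) ≤ K * θ := Nat.floor_le (by positivity)
    have hK' : (0 : ℝ) < K := by exact_mod_cast hK
    have h2 := norm_expSum_mul_le (n := 2 * N) h0 h1
    rw [le_div_iff₀ (by positivity)]
    have h3 : ‖expSum (2 * N) θ‖ * (2 * ⌊K * θ⌋₊) ≤ K := by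
      calc _ ≤ ‖expSum (2 * N) θ‖ * (2 * (K * θ)) := by gcongr
        _ = K * (‖expSum (2 * N) θ‖ * (2 * θ)) := by ring
        _ ≤ K * 1 := by gcongr
        _ = K := mul_one _
    have h4 : 0 ≤ ‖expSum (2 * N) θ‖ * (2 * ⌊K * θ⌋₊) := by positivity
    calc _ = (‖expSum (2 * N) θ‖ * (2 * ⌊K * θ⌋₊)) ^ 2 := by ring
      _ ≤ _ := by gcongr

theorem norm_expSum_sq_le {N K : ℕ} (hK : 0 < K) (θ : ℝ) :
    ‖expSum (2 * N) θ‖ ^ 2 ≤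
      fejerMajorant N K ⌊K * Int.fract θ⌋₊ + fejerMajorant N K ⌊K * (1 - Int.fract θ)⌋₊ := by
  have e : expSum (2 * N) (Int.fract θ) = expSum (2 * N) θ := expSum_sub_intCast _ _ _
  rw [← e]
  have h0 := Int.fract_nonneg θ
  have h1 := (Int.fract_lt_one θ).le
  rcases le_total (Int.fract θ) (1 / 2) with h | h
  · exact (norm_expSum_sq_le_fejerMajorant hK h0 h).trans
      (le_add_of_nonneg_right (fejerMajorant_nonneg _ _ _))
  · have := norm_expSum_sq_le_fejerMajorant (N := N) hK (θ := 1 - Int.fract θ) (by linarith)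
      (by linarith)
    have e2 : ‖expSum (2 * N) (1 - Int.fract θ)‖ = ‖expSum (2 * N) (Int.fract θ)‖ := by
      rw [← norm_expSum_neg, show -(1 - Int.fract θ) = Int.fract θ - (1 : ℤ) by push_cast; ring,
        expSum_sub_intCast]
    rw [e2] at this
    exact this.trans (le_add_of_nonneg_left (fejerMajorant_nonneg _ _ _))

theorem abs_sub_lt_of_floor_mul_eq {K : ℕ} (hK : 0 < K) {s t : ℝ} (hs : 0 ≤ s) (ht : 0 ≤ t)
    (h : ⌊K * s⌋₊ = ⌊K * t⌋₊) : |s - t| < 1 / K := by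
  have hK' : (0 : ℝ) < K := by exact_mod_cast hK
  have a1 := Nat.floor_le (a := K * s) (by positivity)
  have a2 := Nat.lt_floor_add_one (K * s)
  have b1 := Nat.floor_le (a := K * t) (by positivity)
  have b2 := Nat.lt_floor_add_one (K * t)
  rw [h] at a1 a2
  rw [lt_div_iff₀ hK']
  have : |s - t| * K = |(s - t) * K| := by rw [abs_mul, abs_of_pos hK']
  rw [this, abs_lt]
  constructor <;> nlinarith

/-- The spacing puts at most one point in each cell of length 1/K to the right of β modulo 1, and at
most one in each cell to its left. Each side therefore contributes at most the sum of the majorant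
over distinct cells. -/
theorem sum_norm_expSum_sq_le {ι : Type*} {s : Finset ι} {α : ι → ℝ} {N K : ℕ} (hK : 0 < K)
    (hα : ∀ i ∈ s, ∀ j ∈ s, i ≠ j → ∀ k : ℤ, 1 / (K : ℝ) ≤ |α i - α j - k|) (β : ℝ) :
    ∑ j ∈ s, ‖expSum (2 * N) (α j - β)‖ ^ 2 ≤ 8 * (N : ℝ) ^ 2 + (K : ℝ) ^ 2 := by
  have hK' : (0 : ℝ) < K := by exact_mod_cast hK
  have key : ∀ F : ι → ℝ, (∀ j, 0 ≤ F j ∧ F j ≤ 1) →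
      (∀ i j, ∃ k : ℤ, |F i - F j| = |α i - α j - k|) →
      ∑ j ∈ s, fejerMajorant N K ⌊K * F j⌋₊ ≤ 4 * (N : ℝ) ^ 2 + (K : ℝ) ^ 2 / 2 := by
    intro F hF hk
    have hinj : Set.InjOn (fun j => ⌊K * F j⌋₊) s := by
      intro i hi j hj hij
      by_contra hne
      obtain ⟨k, hk⟩ := hk i j
      have h1 := hα i hi j hj hne k
      have h2 := abs_sub_lt_of_floor_mul_eq hK (hF i).1 (hF j).1 hij
      linarith
    rw [← sum_image (f := fun k => fejerMajorant N K k) hinj]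
    -- The cell index K does occur: 1 - fract equals 1 at an integer.
    refine le_trans (sum_le_sum_of_subset_of_nonneg (t := range (K + 1)) ?_
      fun _ _ _ => fejerMajorant_nonneg _ _ _) (sum_fejerMajorant_le N K (K + 1))
    intro k hk
    obtain ⟨j, -, rfl⟩ := mem_image.1 hk
    rw [mem_range, Nat.lt_succ_iff]
    refine Nat.floor_le_of_le ?_
    nlinarith [hF j]
  calc _ ≤ ∑ j ∈ s, (fejerMajorant N K ⌊K * Int.fract (α j - β)⌋₊ +
        fejerMajorant N K ⌊K * (1 - Int.fract (α j - β))⌋₊) :=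
        sum_le_sum fun j _ => norm_expSum_sq_le hK _
    _ ≤ (4 * (N : ℝ) ^ 2 + (K : ℝ) ^ 2 / 2) + (4 * (N : ℝ) ^ 2 + (K : ℝ) ^ 2 / 2) := by
        rw [sum_add_distrib]
        refine add_le_add (key _ (fun j => ⟨Int.fract_nonneg _, (Int.fract_lt_one _).le⟩) ?_)
          (key _ (fun j => ⟨by linarith [Int.fract_lt_one (α j - β)],
            by linarith [Int.fract_nonneg (α j - β)]⟩) ?_)
        · intro i j
          refine ⟨⌊α i - β⌋ - ⌊α j - β⌋, ?_⟩
          simp only [Int.fract]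
          push_cast
          congr 1; ring
        · intro i j
          refine ⟨⌊α i - β⌋ - ⌊α j - β⌋, ?_⟩
          simp only [Int.fract]
          rw [← abs_neg]
          push_cast
          congr 1; ring
    _ = _ := by ring

/-- The exponential polynomial `∑_i c_i e(n α_i)`. -/
noncomputable def expPoly {ι : Type*} (s : Finset ι) (α : ι → ℝ) (c : ι → ℂ) (n : ℤ) : ℂ :=
  ∑ i ∈ s, c i * Complex.exp (Complex.I * ((2 * Real.pi * α i * n : ℝ) : ℂ))

/-- Averaging over differences u - v weights the integers by a Fejér kernel, so the coefficients of
the quadratic form in c are the nonnegative numbers |∑ e(uθ)|², which decay quadratically. -/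
theorem sum_norm_expPoly_sub_sq {ι : Type*} (s : Finset ι) (α : ι → ℝ) (c : ι → ℂ) (M : ℕ) :
    ((∑ u ∈ range M, ∑ v ∈ range M, ‖expPoly s α c ((u : ℤ) - v)‖ ^ 2 : ℝ) : ℂ) =
      ∑ i ∈ s, ∑ j ∈ s, c i * (starRingEnd ℂ) (c j) * (‖expSum M (α i - α j)‖ ^ 2 : ℝ) := by
  have h1 : ∀ i j, ((‖expSum M (α i - α j)‖ ^ 2 : ℝ) : ℂ) = ∑ u ∈ range M, ∑ v ∈ range M,
      Complex.exp (Complex.I * ((2 * Real.pi * α i * ((u : ℤ) - v : ℤ) : ℝ) : ℂ)) *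
        (starRingEnd ℂ)
          (Complex.exp (Complex.I * ((2 * Real.pi * α j * ((u : ℤ) - v : ℤ) : ℝ) : ℂ))) := by
    intro i j
    rw [Complex.ofReal_pow, ← Complex.mul_conj', expSum, map_sum, sum_mul_sum]
    refine sum_congr rfl fun u _ => sum_congr rfl fun v _ => ?_
    simp only [← Complex.exp_conj, map_mul, Complex.conj_I, Complex.conj_ofReal, ← Complex.exp_add]
    congr 1
    push_cast
    ring
  simp only [h1, mul_sum]
  have h2 : ∀ F : ι → ι → ℕ → ℕ → ℂ, ∑ i ∈ s, ∑ j ∈ s, ∑ u ∈ range M, ∑ v ∈ range M, F i j u v =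
      ∑ u ∈ range M, ∑ v ∈ range M, ∑ i ∈ s, ∑ j ∈ s, F i j u v := by
    intro F
    rw [← sum_product' s s fun i j => ∑ u ∈ range M, ∑ v ∈ range M, F i j u v,
      ← sum_product' (range M) (range M) fun u v => ∑ i ∈ s, ∑ j ∈ s, F i j u v]
    have e1 : ∀ p : ι × ι, ∑ u ∈ range M, ∑ v ∈ range M, F p.1 p.2 u v =
        ∑ q ∈ range M ×ˢ range M, F p.1 p.2 q.1 q.2 := fun p =>
      (sum_product' (range M) (range M) fun u v => F p.1 p.2 u v).symm
    have e2 : ∀ q : ℕ × ℕ, ∑ i ∈ s, ∑ j ∈ s, F i j q.1 q.2 =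
        ∑ p ∈ s ×ˢ s, F p.1 p.2 q.1 q.2 := fun q =>
      (sum_product' s s fun i j => F i j q.1 q.2).symm
    simp only [e1, e2]
    exact sum_comm
  rw [h2]
  push_cast
  refine sum_congr rfl fun u _ => sum_congr rfl fun v _ => ?_
  rw [← Complex.mul_conj', expPoly, map_sum, sum_mul_sum]
  refine sum_congr rfl fun i _ => sum_congr rfl fun j _ => ?_
  rw [map_mul]
  push_cast
  ring

/-- Every n < N has the N representations (v + n) - v with v < N, all within the range 2N. -/
theorem mul_sum_norm_expPoly_sq_le {ι : Type*} (s : Finset ι) (α : ι → ℝ) (c : ι → ℂ) (N : ℕ) :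
    N * ∑ n ∈ range N, ‖expPoly s α c n‖ ^ 2 ≤
      ∑ u ∈ range (2 * N), ∑ v ∈ range (2 * N), ‖expPoly s α c ((u : ℤ) - v)‖ ^ 2 := by
  rw [← sum_product' (f := fun u v : ℕ => ‖expPoly s α c ((u : ℤ) - v)‖ ^ 2)]
  have h : (N : ℝ) * ∑ n ∈ range N, ‖expPoly s α c n‖ ^ 2 =
      ∑ p ∈ (range N ×ˢ range N).image (fun p : ℕ × ℕ => (p.1 + p.2, p.1)),
        ‖expPoly s α c ((p.1 : ℤ) - (p.2 : ℤ))‖ ^ 2 := by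
    rw [sum_image, sum_product]
    · simp
    · rintro ⟨a, b⟩ - ⟨c, d⟩ - h
      simp only [Prod.mk.injEq] at h ⊢
      omega
  rw [h]
  refine sum_le_sum_of_subset_of_nonneg ?_ fun _ _ _ => by positivity
  intro p hp
  obtain ⟨⟨a, b⟩, h, rfl⟩ := mem_image.1 hp
  simp only [mem_product, mem_range] at h ⊢
  omega

/-- The dual form of the additive large sieve inequality. -/
theorem sum_norm_expPoly_sq_le {ι : Type*} {s : Finset ι} {α : ι → ℝ} {K : ℕ} (hK : 0 < K)
    (hα : ∀ i ∈ s, ∀ j ∈ s, i ≠ j → ∀ k : ℤ, 1 / (K : ℝ) ≤ |α i - α j - k|) (c : ι → ℂ) (N : ℕ) :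
    ∑ n ∈ range N, ‖expPoly s α c n‖ ^ 2 ≤ 9 * (N + K) * ∑ i ∈ s, ‖c i‖ ^ 2 := by
  -- Lengthening the sum to M ≥ K gives 8M² + K² ≤ 9M², and dividing by M later costs only a
  -- constant.
  set M := N + K with hM
  clear_value M
  have hM0 : (0 : ℝ) < M := by exact_mod_cast (by omega : 0 < M)
  have hKM : (K : ℝ) ≤ M := by exact_mod_cast (by omega : K ≤ M)
  have h1 : ∑ n ∈ range N, ‖expPoly s α c n‖ ^ 2 ≤ ∑ n ∈ range M, ‖expPoly s α c n‖ ^ 2 :=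
    sum_le_sum_of_subset_of_nonneg (range_subset_range.2 (by omega)) fun _ _ _ => by positivity
  have h2 := mul_sum_norm_expPoly_sq_le s α c M
  have h0 := sum_norm_expPoly_sub_sq s α c (2 * M)
  have hT0 : 0 ≤ ∑ u ∈ range (2 * M), ∑ v ∈ range (2 * M),
      ‖expPoly s α c ((u : ℤ) - v)‖ ^ 2 :=
    sum_nonneg fun _ _ => sum_nonneg fun _ _ => sq_nonneg _
  generalize ∑ u ∈ range (2 * M), ∑ v ∈ range (2 * M),
    ‖expPoly s α c ((u : ℤ) - v)‖ ^ 2 = T at h0 h2 hT0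
  have h3 : T ≤ ∑ i ∈ s, ∑ j ∈ s, ‖c i‖ * ‖c j‖ * ‖expSum (2 * M) (α i - α j)‖ ^ 2 := by
    rw [← abs_of_nonneg hT0, ← Real.norm_eq_abs, ← Complex.norm_real, h0]
    refine (norm_sum_le _ _).trans (sum_le_sum fun i _ => (norm_sum_le _ _).trans
      (sum_le_sum fun j _ => le_of_eq ?_))
    simp
  -- Schur's test: |c_i c_j| ≤ (|c_i|² + |c_j|²)/2, after which only the row sums of the kernel
  -- matter.
  have h4 : ∑ i ∈ s, ∑ j ∈ s, ‖c i‖ * ‖c j‖ * ‖expSum (2 * M) (α i - α j)‖ ^ 2 ≤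
      ∑ i ∈ s, ∑ j ∈ s, (‖c i‖ ^ 2 / 2 * ‖expSum (2 * M) (α j - α i)‖ ^ 2 +
        ‖c j‖ ^ 2 / 2 * ‖expSum (2 * M) (α i - α j)‖ ^ 2) := by
    refine sum_le_sum fun i _ => sum_le_sum fun j _ => ?_
    rw [← neg_sub (α i) (α j), norm_expSum_neg, ← add_mul]
    gcongr
    nlinarith [sq_nonneg (‖c i‖ - ‖c j‖)]
  have h5 : ∀ β, ∑ j ∈ s, ‖expSum (2 * M) (α j - β)‖ ^ 2 ≤ 9 * (M : ℝ) ^ 2 := fun β =>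
    (sum_norm_expSum_sq_le hK hα β).trans (by nlinarith)
  have h6 : ∑ i ∈ s, ∑ j ∈ s, (‖c i‖ ^ 2 / 2 * ‖expSum (2 * M) (α j - α i)‖ ^ 2 +
        ‖c j‖ ^ 2 / 2 * ‖expSum (2 * M) (α i - α j)‖ ^ 2) ≤
      9 * (M : ℝ) ^ 2 * ∑ i ∈ s, ‖c i‖ ^ 2 := by
    simp only [sum_add_distrib]
    rw [sum_comm (f := fun i j => ‖c j‖ ^ 2 / 2 * ‖expSum (2 * M) (α i - α j)‖ ^ 2)]
    simp only [← mul_sum]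
    calc _ ≤ ∑ i ∈ s, ‖c i‖ ^ 2 / 2 * (9 * (M : ℝ) ^ 2) +
          ∑ i ∈ s, ‖c i‖ ^ 2 / 2 * (9 * (M : ℝ) ^ 2) := by
          gcongr with i _ i _ <;> exact h5 _
      _ = _ := by rw [← sum_mul, ← sum_div]; ring
  have h7 : (M : ℝ) * ∑ n ∈ range M, ‖expPoly s α c n‖ ^ 2 ≤
      M * (9 * M * ∑ i ∈ s, ‖c i‖ ^ 2) := by
    calc _ ≤ _ := h2.trans (h3.trans (h4.trans h6))
      _ = _ := by ring
  have h8 := le_of_mul_le_mul_left h7 hM0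
  rw [show (N : ℝ) + K = M by simp [hM]]
  exact h1.trans h8

/-- The additive large sieve inequality for `1 / K`-spaced points modulo `1`. -/
theorem additive_large_sieve {ι : Type*} {s : Finset ι} {α : ι → ℝ} {K : ℕ} (hK : 0 < K)
    (hα : ∀ i ∈ s, ∀ j ∈ s, i ≠ j → ∀ k : ℤ, 1 / (K : ℝ) ≤ |α i - α j - k|) (a : ℕ → ℂ) (N : ℕ) :
    ∑ i ∈ s, ‖∑ n ∈ range N, a n * Complex.exp (Complex.I * ((2 * Real.pi * α i * n : ℝ) : ℂ))‖ ^ 2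
      ≤ 9 * (N + K) * ∑ n ∈ range N, ‖a n‖ ^ 2 := by
  set S : ι → ℂ := fun i =>
    ∑ n ∈ range N, a n * Complex.exp (Complex.I * ((2 * Real.pi * α i * n : ℝ) : ℂ)) with hS
  -- Duality: with these coefficients Z = ∑ a_n P(n), so Cauchy–Schwarz and the dual inequality
  -- bound Z² by a multiple of Z.
  set c : ι → ℂ := fun i => (starRingEnd ℂ) (S i) with hc
  set Z := ∑ i ∈ s, ‖S i‖ ^ 2 with hZ
  have hZ0 : 0 ≤ Z := by positivity
  have h1 : (Z : ℂ) = ∑ n ∈ range N, a n * expPoly s α c n := by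
    simp only [hZ, expPoly, mul_sum]
    rw [sum_comm]
    push_cast
    refine sum_congr rfl fun i _ => ?_
    rw [← Complex.mul_conj']
    change S i * c i = _
    rw [hS, sum_mul]
    refine sum_congr rfl fun n _ => ?_
    push_cast
    ring
  have h2 : Z ≤ ∑ n ∈ range N, ‖a n‖ * ‖expPoly s α c n‖ := by
    rw [← abs_of_nonneg hZ0, ← Real.norm_eq_abs, ← Complex.norm_real, h1]
    exact (norm_sum_le _ _).trans (le_of_eq (by simp))
  have h3 : Z ^ 2 ≤ (∑ n ∈ range N, ‖a n‖ ^ 2) * (9 * (N + K) * Z) := by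
    calc Z ^ 2 ≤ (∑ n ∈ range N, ‖a n‖ * ‖expPoly s α c n‖) ^ 2 := by gcongr
      _ ≤ _ := sum_mul_sq_le_sq_mul_sq _ _ _
      _ ≤ _ := by
        gcongr
        refine (sum_norm_expPoly_sq_le hK hα c N).trans (le_of_eq ?_)
        simp [hc, hZ]
  rcases hZ0.eq_or_lt with h | h
  · rw [← h]; positivity
  · exact le_of_mul_le_mul_right (by linarith) h

/-! ### Gauss sums and the multiplicative large sieve -/

open Classical in
/-- The primitive Dirichlet characters mod `r`. -/
noncomputable def primitiveChars (r : ℕ) : Finset (DirichletCharacter ℂ r) :=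
  univ.filter fun ψ => ψ.IsPrimitive

theorem mem_primitiveChars {r : ℕ} {ψ : DirichletCharacter ℂ r} :
    ψ ∈ primitiveChars r ↔ ψ.IsPrimitive := by
  classical simp [primitiveChars]

/-- For primitive χ the discrete Fourier transform of χ is χ⁻¹(-k) times its Gauss sum τ.
Transforming twice and evaluating at -1 gives τ · conj τ = r. -/
theorem norm_gaussSum_sq_of_isPrimitive {r : ℕ} [NeZero r] {χ : DirichletCharacter ℂ r}
    (hχ : χ.IsPrimitive) : ‖gaussSum χ ZMod.stdAddChar‖ ^ 2 = r := by
  have h1 := congrFun (ZMod.dft_dft (χ : ZMod r → ℂ)) (-1)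
  have h2 : ZMod.dft (χ : ZMod r → ℂ) = fun k => χ⁻¹ (-k) * gaussSum χ ZMod.stdAddChar := by
    funext k
    exact hχ.fourierTransform_eq_inv_mul_gaussSum k
  rw [h2, ZMod.dft_apply, neg_neg, map_one, smul_eq_mul, mul_one] at h1
  have h3 : ∑ j : ZMod r, ZMod.stdAddChar (-(j * -1)) • (χ⁻¹ (-j) * gaussSum χ ZMod.stdAddChar) =
      gaussSum χ⁻¹ ZMod.stdAddChar⁻¹ * gaussSum χ ZMod.stdAddChar := by
    generalize gaussSum χ ZMod.stdAddChar = τ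
    rw [gaussSum, sum_mul, ← Equiv.sum_comp (Equiv.neg (ZMod r))]
    refine sum_congr rfl fun j _ => ?_
    simp only [Equiv.neg_apply, neg_neg, smul_eq_mul, mul_neg, mul_one, AddChar.inv_apply]
    ring
  rw [h3, ← star_gaussSum_eq, mul_comm] at h1
  have h4 := Complex.mul_conj' (gaussSum χ ZMod.stdAddChar)
  rw [starRingEnd_apply, h1] at h4
  exact_mod_cast h4.symm

theorem sum_norm_charSum_units_sq {r : ℕ} [NeZero r] (S : (ZMod r)ˣ → ℂ) :
    ∑ χ : DirichletCharacter ℂ r, ‖∑ u : (ZMod r)ˣ, χ u * S u‖ ^ 2 =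
      Nat.totient r * ∑ u, ‖S u‖ ^ 2 := by
  classical
  have key : ∑ χ : DirichletCharacter ℂ r,
      (∑ u : (ZMod r)ˣ, χ u * S u) * (starRingEnd ℂ) (∑ u : (ZMod r)ˣ, χ u * S u) =
      Nat.totient r * ∑ u, S u * (starRingEnd ℂ) (S u) := by
    simp only [map_sum, sum_mul_sum, map_mul]
    rw [sum_comm, mul_sum]
    refine sum_congr rfl fun u _ => ?_
    rw [sum_comm]
    have h : ∀ v : (ZMod r)ˣ, ∑ χ : DirichletCharacter ℂ r,
        χ u * S u * ((starRingEnd ℂ) (χ v) * (starRingEnd ℂ) (S v)) =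
        if v = u then Nat.totient r * (S u * (starRingEnd ℂ) (S v)) else 0 := by
      intro v
      have h1 := DirichletCharacter.sum_char_inv_mul_char_eq ℂ v.isUnit (u : ZMod r)
      have h2 : ∀ χ : DirichletCharacter ℂ r, (starRingEnd ℂ) (χ v) = χ (v : ZMod r)⁻¹ := by
        intro χ
        rw [starRingEnd_apply, MulChar.star_apply', MulChar.inv_apply, Ring.inverse_unit,
          ZMod.inv_coe_unit]
      calc _ = (∑ χ : DirichletCharacter ℂ r, χ (v : ZMod r)⁻¹ * χ u) *
            (S u * (starRingEnd ℂ) (S v)) := by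
            rw [sum_mul]
            refine sum_congr rfl fun χ _ => ?_
            rw [h2]; ring
        _ = _ := by
            rw [h1]
            simp only [Units.val_inj, ite_mul, zero_mul]
    simp only [h, sum_ite_eq', mem_univ, if_true]
  have := congrArg Complex.re key
  simp only [Complex.mul_conj'] at this
  exact_mod_cast this

theorem stdAddChar_mul_natCast {r : ℕ} [NeZero r] (u : ZMod r) (n : ℕ) :
    ZMod.stdAddChar (u * (n : ZMod r)) =
      Complex.exp (Complex.I * ((2 * Real.pi * (u.val / r : ℝ) * n : ℝ) : ℂ)) := by
  have : u * (n : ZMod r) = ((u.val * n : ℕ) : ℤ) := by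
    push_cast
    rw [ZMod.natCast_zmod_val]
  rw [this, ZMod.stdAddChar_coe]
  congr 1
  push_cast
  ring

/-- Passing from primitive multiplicative characters to additive characters. -/
theorem sum_primitiveChars_norm_sq_le {r : ℕ} [NeZero r] (a : ℕ → ℂ) (N : ℕ) :
    (r : ℝ) / Nat.totient r *
        ∑ ψ ∈ primitiveChars r, ‖∑ n ∈ range N, a n * ψ (n : ZMod r)‖ ^ 2 ≤
      ∑ u : (ZMod r)ˣ, ‖∑ n ∈ range N,
        a n * Complex.exp (Complex.I * ((2 * Real.pi * ((u : ZMod r).val / r : ℝ) * n : ℝ) : ℂ))‖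
          ^ 2 := by
  have hr : (0 : ℝ) < r := by exact_mod_cast NeZero.pos r
  have hφ : (0 : ℝ) < Nat.totient r := by exact_mod_cast Nat.totient_pos.2 (NeZero.pos r)
  simp only [← stdAddChar_mul_natCast]
  set S : ZMod r → ℂ := fun b => ∑ n ∈ range N, a n * ZMod.stdAddChar (b * (n : ZMod r)) with hS
  have h1 : ∀ ψ ∈ primitiveChars r, (r : ℝ) * ‖∑ n ∈ range N, a n * ψ (n : ZMod r)‖ ^ 2 =
      ‖∑ u : (ZMod r)ˣ, ψ⁻¹ u * S u‖ ^ 2 := by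
    intro ψ hψ
    have hψ' : (ψ⁻¹).IsPrimitive := by
      rw [DirichletCharacter.isPrimitive_def, DirichletCharacter.conductor_inv]
      exact mem_primitiveChars.1 hψ
    rw [← norm_gaussSum_sq_of_isPrimitive hψ', ← mul_pow, ← norm_mul]
    congr 2
    have h2 : ∑ u : (ZMod r)ˣ, ψ⁻¹ u * S u = ∑ b : ZMod r, ψ⁻¹ b * S b := by
      classical
      refine sum_of_injOn (fun u : (ZMod r)ˣ => (u : ZMod r)) (Units.val_injective.injOn)
        (fun _ _ => by simp) ?_ fun _ _ => rfl
      intro b _ hb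
      have : ¬ IsUnit b := fun h => hb ⟨h.unit, by simp, by simp⟩
      rw [MulChar.map_nonunit _ this, zero_mul]
    rw [h2, hS]
    simp only [mul_sum]
    rw [sum_comm]
    refine sum_congr rfl fun n _ => ?_
    -- Primitivity makes the expansion of ψ(n) in additive characters valid for every n, also for n
    -- not coprime to r.
    have h3 := gaussSum_mulShift_of_isPrimitive (ZMod.stdAddChar (N := r)) hψ' (n : ZMod r)
    rw [inv_inv] at h3
    rw [mul_left_comm, mul_comm (gaussSum _ _), ← h3, gaussSum, mul_sum]
    refine sum_congr rfl fun b _ => ?_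
    rw [AddChar.mulShift_apply, mul_comm b]
    ring
  -- The sum over primitive characters is enlarged to all characters mod r, where Parseval is exact.
  have h4 : (r : ℝ) * ∑ ψ ∈ primitiveChars r, ‖∑ n ∈ range N, a n * ψ (n : ZMod r)‖ ^ 2 ≤
      Nat.totient r * ∑ u : (ZMod r)ˣ, ‖S u‖ ^ 2 := by
    rw [← sum_norm_charSum_units_sq fun u : (ZMod r)ˣ => S u, mul_sum, sum_congr rfl h1,
      ← Equiv.sum_comp (Equiv.inv (DirichletCharacter ℂ r))]
    exact sum_le_sum_of_subset_of_nonneg (subset_univ _) fun _ _ _ => by positivity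
  rw [div_mul_eq_mul_div, div_le_iff₀ hφ, mul_comm (∑ u : (ZMod r)ˣ, _)]
  exact h4

/-- The difference is z/(r r') with z an integer. If z vanished, coprimality would force r = r', and
then b ≡ b' mod r with both in [0, r), so the fractions would coincide. -/
theorem farey_spacing {R r r' b b' : ℕ} (hr : 0 < r) (hr' : 0 < r') (hrR : r ≤ R) (hrR' : r' ≤ R)
    (hb : b < r) (hb' : b' < r') (hc : b.Coprime r) (hc' : b'.Coprime r')
    (hne : (r, b) ≠ (r', b')) (k : ℤ) :
    1 / ((R ^ 2 : ℕ) : ℝ) ≤ |(b / r : ℝ) - (b' / r' : ℝ) - k| := by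
  have hr0 : (0 : ℝ) < r := by exact_mod_cast hr
  have hr0' : (0 : ℝ) < r' := by exact_mod_cast hr'
  set z : ℤ := b * r' - b' * r - k * r * r' with hz
  have e : (b / r : ℝ) - (b' / r' : ℝ) - k = (z : ℝ) / (r * r') := by
    rw [hz]; push_cast; field_simp
  have hz0 : z ≠ 0 := by
    intro h0
    have h1 : (b * r' : ℤ) = b' * r + k * r * r' := by linarith
    have d1 : (r : ℤ) ∣ b * r' := ⟨b' + k * r', by rw [h1]; ring⟩
    have d2 : (r' : ℤ) ∣ b' * r := ⟨b - k * r, by linear_combination -h1⟩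
    have d1' : r ∣ r' := hc.symm.dvd_of_dvd_mul_left (by exact_mod_cast d1)
    have d2' : r' ∣ r := hc'.symm.dvd_of_dvd_mul_left (by exact_mod_cast d2)
    obtain rfl := Nat.dvd_antisymm d1' d2'
    have h2 : (b : ℤ) = b' + k * r := by
      have : (r : ℤ) ≠ 0 := by exact_mod_cast hr.ne'
      apply mul_right_cancel₀ this
      linear_combination h1
    have hk : k = 0 := by
      by_contra hk
      rcases lt_or_gt_of_ne hk with h | h
      · have : k * r ≤ -1 * r := by gcongr; omega
        omega
      · have : 1 * (r : ℤ) ≤ k * r := by gcongr; omega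
        omega
    apply hne
    rw [hk] at h2
    simp only [Prod.mk.injEq, true_and]
    omega
  have hz1 : (1 : ℝ) ≤ |(z : ℝ)| := by exact_mod_cast Int.one_le_abs hz0
  rw [e, abs_div, abs_of_pos (mul_pos hr0 hr0')]
  have : (r : ℝ) * r' ≤ ((R ^ 2 : ℕ) : ℝ) := by
    push_cast
    rw [pow_two]
    gcongr
  gcongr

/-- The multiplicative large sieve inequality. -/
theorem multiplicative_large_sieve {R : ℕ} (hR : 0 < R) (a : ℕ → ℂ) (N : ℕ) :
    ∑ r ∈ Icc 1 R, (r : ℝ) / Nat.totient r *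
        ∑ ψ ∈ primitiveChars r, ‖∑ n ∈ range N, a n * ψ (n : ZMod r)‖ ^ 2 ≤
      9 * (N + R ^ 2) * ∑ n ∈ range N, ‖a n‖ ^ 2 := by
  have h := additive_large_sieve (s := (Icc 1 R).sigma fun r => (range r).filter (·.Coprime r))
    (α := fun p => (p.2 / p.1 : ℝ)) (K := R ^ 2) (by positivity) (by
      rintro ⟨r, b⟩ h ⟨r', b'⟩ h' hne k
      simp only [mem_sigma, mem_Icc, mem_filter, mem_range] at h h'
      refine farey_spacing (by omega) (by omega) h.1.2 h'.1.2 h.2.1 h'.2.1 h.2.2 h'.2.2 ?_ k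
      rintro ⟨⟩
      exact hne rfl) a N
  push_cast at h
  refine le_trans ?_ h
  rw [sum_sigma]
  refine sum_le_sum fun r hr => ?_
  have : NeZero r := ⟨by have := (mem_Icc.1 hr).1; omega⟩
  refine (sum_primitiveChars_norm_sq_le a N).trans ?_
  rw [← sum_image (s := (univ : Finset (ZMod r)ˣ)) (g := fun u => (u : ZMod r).val)
    (f := fun b : ℕ => ‖∑ n ∈ range N,
        a n * Complex.exp (Complex.I * ((2 * Real.pi * (b / r : ℝ) * n : ℝ) : ℂ))‖ ^ 2)
    (fun u _ v _ huv => Units.ext (ZMod.val_injective r huv))]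
  refine le_trans (sum_le_sum_of_subset_of_nonneg ?_ fun _ _ _ => by positivity)
    (le_of_eq (sum_congr rfl fun b _ => ?_))
  · intro b hb
    obtain ⟨u, -, rfl⟩ := mem_image.1 hb
    exact mem_filter.2 ⟨mem_range.2 (ZMod.val_lt _), ZMod.val_coe_unit_coprime u⟩
  · push_cast
    rfl

/-! ### Separation of variables and bilinear sums over large conductors -/

/-- The binary decomposition of the inequality `n < k`: the two numbers agree above the `j`-th
binary digit, which is `0` in `n` and `1` in `k`. -/
theorem ite_lt_eq_sum_range (J : ℕ) : ∀ n k : ℕ, k < 2 ^ J →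
    (if n < k then (1 : ℂ) else 0) = ∑ j ∈ range J,
      if n / 2 ^ (j + 1) = k / 2 ^ (j + 1) ∧ (n / 2 ^ j) % 2 = 0 ∧ (k / 2 ^ j) % 2 = 1
        then (1 : ℂ) else 0 := by
  induction J with
  | zero =>
    intro n k hk
    have : ¬ n < k := by simp at hk; omega
    simp [this]
  | succ J ih =>
    intro n k hk
    have h2 : k / 2 < 2 ^ J := by rw [pow_succ] at hk; omega
    rw [sum_range_succ']
    have h3 : ∀ a j : ℕ, a / 2 ^ (j + 1) = a / 2 / 2 ^ j := fun a j => by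
      rw [pow_succ', Nat.div_div_eq_div_mul]
    simp only [h3 _ (_ + 1), h3 _ _, pow_zero, Nat.div_one]
    -- Either the halves already decide n < k, or they agree and the last digits are 0 and 1; these
    -- cases exclude each other.
    have := ih (n / 2) (k / 2) h2
    simp only [h3 _ _] at this
    rw [← this]
    by_cases ha : n / 2 < k / 2
    · have hb : n < k := by omega
      have hc : ¬ (n / 2 = k / 2 ∧ n % 2 = 0 ∧ k % 2 = 1) := by omega
      simp [ha, hb, hc]
    · by_cases hb : n < k
      · have hc : n / 2 = k / 2 ∧ n % 2 = 0 ∧ k % 2 = 1 := by omega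
        simp [hb, hc]
      · have hc : ¬ (n / 2 = k / 2 ∧ n % 2 = 0 ∧ k % 2 = 1) := by omega
        simp [ha, hb, hc]

/-- A large sieve inequality for `ψ` gives a bound for the bilinear sums twisted by `ψ`, with
disjointly supported families of coefficients. -/
theorem sum_mul_norm_sum_mul_le {ι : Type*} (s : Finset ι) (w : ι → ℝ) (hw : ∀ i ∈ s, 0 ≤ w i)
    (ψ : ι → ℕ → ℂ) {A B : ℕ} {ΔA ΔB U V : ℝ} (hΔA : 0 ≤ ΔA) (hΔB : 0 ≤ ΔB)
    (hA : ∀ a : ℕ → ℂ, ∑ i ∈ s, w i * ‖∑ n ∈ range A, a n * ψ i n‖ ^ 2 ≤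
      ΔA * ∑ n ∈ range A, ‖a n‖ ^ 2)
    (hB : ∀ b : ℕ → ℂ, ∑ i ∈ s, w i * ‖∑ n ∈ range B, b n * ψ i n‖ ^ 2 ≤
      ΔB * ∑ n ∈ range B, ‖b n‖ ^ 2)
    (a b : ℕ → ℂ) (hU0 : 0 ≤ U) (hV0 : 0 ≤ V)
    (hU : ΔA * ∑ n ∈ range A, ‖a n‖ ^ 2 ≤ U ^ 2) (hV : ΔB * ∑ n ∈ range B, ‖b n‖ ^ 2 ≤ V ^ 2)
    (p q : ℕ → ℕ) (P Q : ℕ → Prop) [DecidablePred P] [DecidablePred Q] (T : ℕ)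
    (hp : ∀ m, p m < T) :
    ∑ i ∈ s, w i * ‖∑ m ∈ range A, ∑ n ∈ range B,
      (if q n = p m ∧ Q n ∧ P m then (1 : ℂ) else 0) * (a m * ψ i m * (b n * ψ i n))‖ ≤ U * V := by
  have key : ∀ (Δ : ℝ) (N : ℕ) (c : ℕ → ℂ) (p : ℕ → ℕ) (P : ℕ → Prop) [DecidablePred P],
      0 ≤ Δ → (∀ a : ℕ → ℂ, ∑ i ∈ s, w i * ‖∑ n ∈ range N, a n * ψ i n‖ ^ 2 ≤
      Δ * ∑ n ∈ range N, ‖a n‖ ^ 2) → ∑ i ∈ s, ∑ t ∈ range T,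
        w i * ‖∑ n ∈ range N, (if p n = t ∧ P n then c n else 0) * ψ i n‖ ^ 2 ≤
      Δ * ∑ n ∈ range N, ‖c n‖ ^ 2 := by
    intro Δ N c p P _ hΔ h
    rw [sum_comm]
    -- The pieces with p n = t have disjoint supports, so their squared norms add up to at most that
    -- of c: summing over t is free.
    refine (sum_le_sum fun t _ => h _).trans ?_
    rw [← mul_sum, sum_comm]
    gcongr with n hn
    calc ∑ t ∈ range T, ‖if p n = t ∧ P n then c n else 0‖ ^ 2
        ≤ ∑ t ∈ range T, if p n = t then ‖c n‖ ^ 2 else 0 := by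
          refine sum_le_sum fun t _ => ?_
          by_cases h1 : p n = t <;> by_cases h2 : P n <;> simp [h1, h2]
      _ ≤ _ := by
          rw [sum_ite_eq]
          split_ifs
          · exact le_rfl
          · positivity
  have e : ∀ i, ∑ m ∈ range A, ∑ n ∈ range B,
      (if q n = p m ∧ Q n ∧ P m then (1 : ℂ) else 0) * (a m * ψ i m * (b n * ψ i n)) =
      ∑ t ∈ range T, (∑ m ∈ range A, (if p m = t ∧ P m then a m else 0) * ψ i m) *
        (∑ n ∈ range B, (if q n = t ∧ Q n then b n else 0) * ψ i n) := by
    intro i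
    simp only [sum_mul_sum]
    conv_rhs => rw [sum_comm]
    refine sum_congr rfl fun m _ => ?_
    rw [sum_comm]
    refine sum_congr rfl fun n _ => ?_
    rw [sum_eq_single_of_mem (p m) (mem_range.2 (hp m))]
    · by_cases h1 : q n = p m <;> by_cases h2 : Q n <;> by_cases h3 : P m <;> simp [h1, h2, h3]
    · intro t _ ht
      simp [Ne.symm ht]
  set F : ι → ℕ → ℂ := fun i t => ∑ m ∈ range A, (if p m = t ∧ P m then a m else 0) * ψ i m
  set G : ι → ℕ → ℂ := fun i t => ∑ n ∈ range B, (if q n = t ∧ Q n then b n else 0) * ψ i n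
  have h1 := (key ΔA A a p P hΔA hA).trans hU
  have h2 := (key ΔB B b q Q hΔB hB).trans hV
  calc _ ≤ ∑ i ∈ s, ∑ t ∈ range T,
        (Real.sqrt (w i) * ‖F i t‖) * (Real.sqrt (w i) * ‖G i t‖) := by
        refine sum_le_sum fun i hi => ?_
        rw [e i]
        refine (mul_le_mul_of_nonneg_left (norm_sum_le _ _) (hw i hi)).trans (le_of_eq ?_)
        rw [mul_sum]
        refine sum_congr rfl fun t _ => ?_
        rw [norm_mul]
        nth_rw 1 [← Real.mul_self_sqrt (hw i hi)]
        ring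
    _ ≤ U * V := by
        rw [← sum_product' (f := fun i t =>
          (Real.sqrt (w i) * ‖F i t‖) * (Real.sqrt (w i) * ‖G i t‖))]
        refine abs_le_of_sq_le_sq' ?_ (by positivity) |>.2
        refine (sum_mul_sq_le_sq_mul_sq _ _ _).trans ?_
        rw [mul_pow]
        have e2 : ∀ H : ι → ℕ → ℂ, ∑ x ∈ s ×ˢ range T, (Real.sqrt (w x.1) * ‖H x.1 x.2‖) ^ 2 =
            ∑ i ∈ s, ∑ t ∈ range T, w i * ‖H i t‖ ^ 2 := by
          intro H
          rw [sum_product]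
          refine sum_congr rfl fun i hi => sum_congr rfl fun t _ => ?_
          rw [mul_pow, Real.sq_sqrt (hw i hi)]
        rw [e2 F, e2 G]
        refine mul_le_mul h1 h2 ?_ (by positivity)
        exact sum_nonneg fun i hi => sum_nonneg fun t _ => mul_nonneg (hw i hi) (sq_nonneg _)

/-- Separation of variables in a bilinear sum with the summation condition `n < κ m`. -/
theorem sum_mul_norm_sum_cut_le {ι : Type*} (s : Finset ι) (w : ι → ℝ) (hw : ∀ i ∈ s, 0 ≤ w i)
    (ψ : ι → ℕ → ℂ) {A B : ℕ} {ΔA ΔB U V : ℝ} (hΔA : 0 ≤ ΔA) (hΔB : 0 ≤ ΔB)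
    (hA : ∀ a : ℕ → ℂ, ∑ i ∈ s, w i * ‖∑ n ∈ range A, a n * ψ i n‖ ^ 2 ≤
      ΔA * ∑ n ∈ range A, ‖a n‖ ^ 2)
    (hB : ∀ b : ℕ → ℂ, ∑ i ∈ s, w i * ‖∑ n ∈ range B, b n * ψ i n‖ ^ 2 ≤
      ΔB * ∑ n ∈ range B, ‖b n‖ ^ 2)
    (a b : ℕ → ℂ) (hU0 : 0 ≤ U) (hV0 : 0 ≤ V)
    (hU : ΔA * ∑ n ∈ range A, ‖a n‖ ^ 2 ≤ U ^ 2) (hV : ΔB * ∑ n ∈ range B, ‖b n‖ ^ 2 ≤ V ^ 2)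
    (κ : ℕ → ℕ) (J : ℕ) (hκ : ∀ m, κ m < 2 ^ J) :
    ∑ i ∈ s, w i * ‖∑ m ∈ range A, ∑ n ∈ range B,
      (if n < κ m then (1 : ℂ) else 0) * (a m * ψ i m * (b n * ψ i n))‖ ≤ J * (U * V) := by
  have e : ∀ i, ∑ m ∈ range A, ∑ n ∈ range B,
      (if n < κ m then (1 : ℂ) else 0) * (a m * ψ i m * (b n * ψ i n)) =
      ∑ j ∈ range J, ∑ m ∈ range A, ∑ n ∈ range B,
        (if n / 2 ^ (j + 1) = κ m / 2 ^ (j + 1) ∧ (n / 2 ^ j) % 2 = 0 ∧ (κ m / 2 ^ j) % 2 = 1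
          then (1 : ℂ) else 0) * (a m * ψ i m * (b n * ψ i n)) := by
    intro i
    conv_rhs => rw [sum_comm]
    refine sum_congr rfl fun m _ => ?_
    rw [sum_comm]
    refine sum_congr rfl fun n _ => ?_
    rw [ite_lt_eq_sum_range J n (κ m) (hκ m), sum_mul]
  calc _ ≤ ∑ i ∈ s, ∑ j ∈ range J, w i * ‖∑ m ∈ range A, ∑ n ∈ range B,
        (if n / 2 ^ (j + 1) = κ m / 2 ^ (j + 1) ∧ (n / 2 ^ j) % 2 = 0 ∧ (κ m / 2 ^ j) % 2 = 1
          then (1 : ℂ) else 0) * (a m * ψ i m * (b n * ψ i n))‖ := by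
        refine sum_le_sum fun i hi => ?_
        rw [e i, ← mul_sum]
        exact mul_le_mul_of_nonneg_left (norm_sum_le _ _) (hw i hi)
    _ ≤ ∑ j ∈ range J, U * V := by
        rw [sum_comm]
        refine sum_le_sum fun j _ => ?_
        -- For a fixed digit j the two variables are linked only through the equality of their
        -- higher digits.
        exact sum_mul_norm_sum_mul_le s w hw ψ hΔA hΔB hA hB a b hU0 hV0 hU hV
          (fun m => κ m / 2 ^ (j + 1)) (fun n => n / 2 ^ (j + 1))
          (fun m => (κ m / 2 ^ j) % 2 = 1) (fun n => (n / 2 ^ j) % 2 = 0) (2 ^ J)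
          (fun m => (Nat.div_le_self _ _).trans_lt (hκ m))
    _ = _ := by simp

theorem multiplicative_large_sieve_sigma {P : ℕ} (hP : 0 < P) (a : ℕ → ℂ) (N : ℕ) :
    ∑ i ∈ (Ico P (2 * P)).sigma primitiveChars, (i.1 : ℝ) / Nat.totient i.1 *
        ‖∑ n ∈ range N, a n * i.2 (n : ZMod i.1)‖ ^ 2 ≤
      9 * (N + 4 * P ^ 2) * ∑ n ∈ range N, ‖a n‖ ^ 2 := by
  have h := multiplicative_large_sieve (R := 2 * P) (by omega) a N
  rw [sum_sigma]
  calc _ = ∑ r ∈ Ico P (2 * P), (r : ℝ) / Nat.totient r *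
        ∑ ψ ∈ primitiveChars r, ‖∑ n ∈ range N, a n * ψ (n : ZMod r)‖ ^ 2 := by
        simp only [mul_sum]
    _ ≤ _ := sum_le_sum_of_subset_of_nonneg (fun r hr => by
        rw [mem_Ico] at hr; rw [mem_Icc]; omega) fun _ _ _ => by positivity
    _ ≤ _ := h
    _ = _ := by push_cast; ring

/-- `∑_{m n ≤ X} a(m) b(n) ψ(m) ψ(n)`. -/
noncomputable def bilinearCharSum (a b : ℕ → ℂ) (X : ℕ) {r : ℕ} (ψ : DirichletCharacter ℂ r) : ℂ :=
  ∑ m ∈ Icc 1 X, ∑ n ∈ Icc 1 (X / m), a m * ψ (m : ZMod r) * (b n * ψ (n : ZMod r))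

theorem sum_range_norm_sq_le {a : ℕ → ℂ} (ha : ∀ n, ‖a n‖ ≤ 1) (N : ℕ) :
    ∑ n ∈ range N, ‖a n‖ ^ 2 ≤ N := by
  calc _ ≤ ∑ n ∈ range N, (1 : ℝ) :=
        sum_le_sum fun n _ => pow_le_one₀ (norm_nonneg _) (ha n)
    _ = N := by simp

/-- The contribution of a dyadic box. -/
theorem sum_norm_dyadic_box_le {X M P J k : ℕ} (hM : 0 < M) (hP : 0 < P) (hJ : X + 1 < 2 ^ J)
    {a b : ℕ → ℂ} (ha : ∀ n, ‖a n‖ ≤ 1) (hb : ∀ n, ‖b n‖ ≤ 1)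
    (ha0 : ∀ n ≤ M, a n = 0) (hb0 : ∀ n ≤ M, b n = 0) :
    ∑ i ∈ (Ico P (2 * P)).sigma primitiveChars, (i.1 : ℝ) / Nat.totient i.1 *
      ‖∑ m ∈ Ico (2 ^ k) (2 ^ (k + 1)), ∑ n ∈ Icc 1 (X / m),
        a m * i.2 (m : ZMod i.1) * (b n * i.2 (n : ZMod i.1))‖ ≤
      J * (36 * X + 144 * P * (X / Real.sqrt M) + 72 * P ^ 2 * Real.sqrt X) := by
  have hrhs : 0 ≤ J * (36 * X + 144 * P * (X / Real.sqrt M) + 72 * P ^ 2 * Real.sqrt X) := by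
    positivity
  by_cases h1 : 2 ^ (k + 1) ≤ M
  · refine le_trans (le_of_eq (sum_eq_zero fun i _ => ?_)) hrhs
    rw [sum_eq_zero, norm_zero, mul_zero]
    intro m hm
    rw [ha0 m (by rw [mem_Ico] at hm; omega)]
    simp
  by_cases h2 : X / 2 ^ k ≤ M
  · refine le_trans (le_of_eq (sum_eq_zero fun i _ => ?_)) hrhs
    rw [sum_eq_zero, norm_zero, mul_zero]
    intro m hm
    refine sum_eq_zero fun n hn => ?_
    have : X / m ≤ X / 2 ^ k := Nat.div_le_div_left (mem_Ico.1 hm).1 (by positivity)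
    rw [hb0 n (by rw [mem_Icc] at hn; omega)]
    simp
  push Not at h1 h2
  set A := 2 ^ (k + 1) with hA
  set B := X / 2 ^ k + 1 with hB
  -- The lower cutoff goes into the coefficients, so that m runs over an initial segment as in the
  -- large sieve.
  set a' : ℕ → ℂ := fun m => if 2 ^ k ≤ m then a m else 0 with ha'
  have ha'1 : ∀ n, ‖a' n‖ ≤ 1 := fun n => by
    simp only [ha']; split_ifs
    · exact ha n
    · simp
  have e : ∀ i : Σ r : ℕ, DirichletCharacter ℂ r,
      ∑ m ∈ Ico (2 ^ k) A, ∑ n ∈ Icc 1 (X / m),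
        a m * i.2 (m : ZMod i.1) * (b n * i.2 (n : ZMod i.1)) =
      ∑ m ∈ range A, ∑ n ∈ range B, (if n < X / m + 1 then (1 : ℂ) else 0) *
        (a' m * i.2 (m : ZMod i.1) * (b n * i.2 (n : ZMod i.1))) := by
    intro i
    refine sum_subset_zero_on_sdiff ?_ ?_ ?_
    · intro m hm; rw [mem_Ico] at hm; exact mem_range.2 hm.2
    · intro m hm
      rw [mem_sdiff, mem_range, mem_Ico] at hm
      have : ¬ 2 ^ k ≤ m := by omega
      simp [ha', this]
    · intro m hm
      rw [mem_Ico] at hm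
      refine sum_subset_zero_on_sdiff ?_ ?_ ?_
      · intro n hn
        have : X / m ≤ X / 2 ^ k := Nat.div_le_div_left hm.1 (by positivity)
        rw [mem_Icc] at hn; rw [mem_range]; omega
      · intro n hn
        rw [mem_sdiff, mem_range, mem_Icc] at hn
        by_cases hn0 : n = 0
        · rw [hb0 n (by omega)]; simp
        · have : ¬ n < X / m + 1 := by omega
          rw [if_neg this, zero_mul]
      · intro n hn
        rw [mem_Icc] at hn
        have : n < X / m + 1 := by omega
        simp only [ha', if_pos this, if_pos hm.1, one_mul]
  simp only [e]
  have hM' : (0 : ℝ) < M := by exact_mod_cast hM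
  have hAX : (A : ℝ) * M ≤ 2 * X := by
    have : M * 2 ^ k ≤ X := (Nat.mul_le_mul_right _ h2.le).trans (Nat.div_mul_le_self _ _)
    have : A * M ≤ 2 * X := by rw [hA, pow_succ]; nlinarith
    exact_mod_cast this
  have hAB : (A : ℝ) * B ≤ 4 * X := by
    have h3 : X / 2 ^ k * 2 ^ k ≤ X := Nat.div_mul_le_self _ _
    have h4 : 2 ^ k ≤ X := by nlinarith
    have : A * B ≤ 4 * X := by rw [hA, hB, pow_succ]; nlinarith
    exact_mod_cast this
  have hBX : (B : ℝ) * M ≤ 4 * X := by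
    have : (M : ℝ) ≤ A := by exact_mod_cast h1.le
    have hB0 : (0 : ℝ) ≤ B := by positivity
    nlinarith
  set α := Real.sqrt A with hα
  set β := Real.sqrt B with hβ
  have hα0 : 0 ≤ α := Real.sqrt_nonneg _
  have hβ0 : 0 ≤ β := Real.sqrt_nonneg _
  have hα2 : α ^ 2 = A := Real.sq_sqrt (by positivity)
  have hβ2 : β ^ 2 = B := Real.sq_sqrt (by positivity)
  have hP' : (0 : ℝ) ≤ P := by positivity
  -- With γ = √N this is N + 4P² ≤ (γ + 2P)², which makes the two large sieve factors easy to
  -- multiply out.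
  have bound : ∀ (N : ℕ) (c : ℕ → ℂ) (γ : ℝ), 0 ≤ γ → γ ^ 2 = N → (∀ n, ‖c n‖ ≤ 1) →
      9 * ((N : ℝ) + 4 * P ^ 2) * ∑ n ∈ range N, ‖c n‖ ^ 2 ≤ (3 * (γ + 2 * P) * γ) ^ 2 := by
    intro N c γ hγ hγ2 hc
    calc _ ≤ 9 * ((N : ℝ) + 4 * P ^ 2) * N := by gcongr; exact sum_range_norm_sq_le hc N
      _ ≤ _ := by
        rw [← hγ2]
        have : 0 ≤ γ ^ 2 * (γ * P) := by positivity
        nlinarith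
  have main := sum_mul_norm_sum_cut_le ((Ico P (2 * P)).sigma primitiveChars)
    (fun i => (i.1 : ℝ) / Nat.totient i.1) (fun i _ => by positivity)
    (fun i n => i.2 (n : ZMod i.1)) (A := A) (B := B)
    (by positivity) (by positivity)
    (fun c => multiplicative_large_sieve_sigma hP c A)
    (fun c => multiplicative_large_sieve_sigma hP c B) a' b
    (by positivity) (by positivity) (bound A a' α hα0 hα2 ha'1) (bound B b β hβ0 hβ2 hb)
    (fun m => X / m + 1) J (fun m => by have := Nat.div_le_self X m; omega)
  refine main.trans ?_
  gcongr
  have hX : Real.sqrt X ^ 2 = X := Real.sq_sqrt (by positivity)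
  have hsM : 0 < Real.sqrt M := Real.sqrt_pos.2 hM'
  have hαβ : α * β ≤ 2 * Real.sqrt X := by
    rw [hα, hβ, ← Real.sqrt_mul (by positivity), show (2 : ℝ) = Real.sqrt 4 by
      rw [show (4 : ℝ) = 2 ^ 2 by norm_num, Real.sqrt_sq (by norm_num)],
      ← Real.sqrt_mul (by norm_num)]
    exact Real.sqrt_le_sqrt hAB
  have hle : ∀ (N : ℕ), (N : ℝ) * M ≤ 4 * X → Real.sqrt N ≤ 2 * Real.sqrt X / Real.sqrt M := by
    intro N hN
    rw [le_div_iff₀ hsM, ← Real.sqrt_mul (by positivity), show (2 : ℝ) = Real.sqrt 4 by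
      rw [show (4 : ℝ) = 2 ^ 2 by norm_num, Real.sqrt_sq (by norm_num)],
      ← Real.sqrt_mul (by norm_num)]
    exact Real.sqrt_le_sqrt hN
  have hα3 : α ≤ 2 * Real.sqrt X / Real.sqrt M := hle A (by linarith [show (0:ℝ) ≤ X by positivity])
  have hβ3 : β ≤ 2 * Real.sqrt X / Real.sqrt M := hle B hBX
  calc 3 * (α + 2 * P) * α * (3 * (β + 2 * P) * β)
      = 9 * (α * β) * (α * β + 2 * P * (α + β) + 4 * P ^ 2) := by ring
    _ ≤ 9 * (2 * Real.sqrt X) * (2 * Real.sqrt X + 2 * P * (2 * Real.sqrt X / Real.sqrt M +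
        2 * Real.sqrt X / Real.sqrt M) + 4 * P ^ 2) := by gcongr
    _ = 36 * Real.sqrt X ^ 2 + 144 * P * (Real.sqrt X ^ 2 / Real.sqrt M) +
        72 * P ^ 2 * Real.sqrt X := by ring
    _ = _ := by rw [hX]

theorem sum_Ico_one_two_pow {E : Type*} [AddCommMonoid E] (F : ℕ → E) (J : ℕ) :
    ∑ m ∈ Ico 1 (2 ^ J), F m = ∑ k ∈ range J, ∑ m ∈ Ico (2 ^ k) (2 ^ (k + 1)), F m := by
  induction J with
  | zero => simp
  | succ J ih =>
    rw [sum_range_succ, ← ih, sum_Ico_consecutive]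
    · exact Nat.one_le_two_pow
    · exact Nat.pow_le_pow_right (by norm_num) (by omega)

/-- Bilinear sums twisted by the primitive characters with modulus in a dyadic range. -/
theorem sum_norm_bilinearCharSum_dyadic_le {X M P J : ℕ} (hM : 0 < M) (hP : 0 < P)
    (hJ : X + 1 < 2 ^ J) {a b : ℕ → ℂ} (ha : ∀ n, ‖a n‖ ≤ 1) (hb : ∀ n, ‖b n‖ ≤ 1)
    (ha0 : ∀ n ≤ M, a n = 0) (hb0 : ∀ n ≤ M, b n = 0) :
    ∑ r ∈ Ico P (2 * P), 1 / (Nat.totient r : ℝ) *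
      ∑ ψ ∈ primitiveChars r, ‖bilinearCharSum a b X ψ‖ ≤
      J ^ 2 * (36 * (X / P) + 144 * (X / Real.sqrt M) + 72 * P * Real.sqrt X) := by
  have hP' : (0 : ℝ) < P := by exact_mod_cast hP
  have e : ∀ i : Σ r : ℕ, DirichletCharacter ℂ r, bilinearCharSum a b X i.2 =
      ∑ k ∈ range J, ∑ m ∈ Ico (2 ^ k) (2 ^ (k + 1)), ∑ n ∈ Icc 1 (X / m),
        a m * i.2 (m : ZMod i.1) * (b n * i.2 (n : ZMod i.1)) := by
    intro i
    rw [← sum_Ico_one_two_pow]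
    refine sum_subset (fun m hm => ?_) fun m hm hm' => ?_
    · rw [mem_Icc] at hm; rw [mem_Ico]; omega
    · rw [mem_Ico] at hm
      rw [mem_Icc] at hm'
      rw [Nat.div_eq_of_lt (by omega)]
      simp
  have h1 : (P : ℝ) * ∑ r ∈ Ico P (2 * P), 1 / (Nat.totient r : ℝ) *
      ∑ ψ ∈ primitiveChars r, ‖bilinearCharSum a b X ψ‖ ≤
      ∑ i ∈ (Ico P (2 * P)).sigma primitiveChars, (i.1 : ℝ) / Nat.totient i.1 *
        ‖bilinearCharSum a b X i.2‖ := by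
    rw [sum_sigma, mul_sum]
    refine sum_le_sum fun r hr => ?_
    have : (P : ℝ) ≤ r := by exact_mod_cast (mem_Ico.1 hr).1
    change _ ≤ ∑ ψ ∈ primitiveChars r, (r : ℝ) / Nat.totient r * ‖bilinearCharSum a b X ψ‖
    rw [← mul_sum, ← mul_assoc, mul_one_div]
    gcongr
  have h2 : ∑ i ∈ (Ico P (2 * P)).sigma primitiveChars, (i.1 : ℝ) / Nat.totient i.1 *
        ‖bilinearCharSum a b X i.2‖ ≤
      ∑ k ∈ range J, J * (36 * X + 144 * P * (X / Real.sqrt M) + 72 * P ^ 2 * Real.sqrt X) := by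
    refine le_trans ?_ (sum_le_sum fun k _ => sum_norm_dyadic_box_le (k := k) hM hP hJ ha hb ha0 hb0)
    rw [sum_comm]
    refine sum_le_sum fun i _ => ?_
    rw [e i, ← mul_sum]
    gcongr
    exact norm_sum_le _ _
  rw [sum_const, card_range, nsmul_eq_mul] at h2
  refine le_of_mul_le_mul_left ((h1.trans h2).trans (le_of_eq ?_)) hP'
  field_simp

/-- Bilinear sums twisted by the primitive characters of large modulus. -/
theorem sum_norm_bilinearCharSum_le {X M R Q J : ℕ} (hM : 0 < M) (hR : 0 < R)
    (hJ : X + 1 < 2 ^ J) (hQ : Q ≤ X) {a b : ℕ → ℂ} (ha : ∀ n, ‖a n‖ ≤ 1) (hb : ∀ n, ‖b n‖ ≤ 1)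
    (ha0 : ∀ n ≤ M, a n = 0) (hb0 : ∀ n ≤ M, b n = 0) :
    ∑ r ∈ Ioc R Q, 1 / (Nat.totient r : ℝ) *
      ∑ ψ ∈ primitiveChars r, ‖bilinearCharSum a b X ψ‖ ≤
      J ^ 2 * (J * (72 * (X / R) + 144 * (X / Real.sqrt M)) + 144 * Q * Real.sqrt X) := by
  rcases Nat.eq_zero_or_pos Q with rfl | hQ0
  · simp; positivity
  have hR' : (0 : ℝ) < R := by exact_mod_cast hR
  set F : ℕ → ℝ := fun r => 1 / (Nat.totient r : ℝ) *
      ∑ ψ ∈ primitiveChars r, ‖bilinearCharSum a b X ψ‖ with hF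
  have hF0 : ∀ r, 0 ≤ F r := fun r => by positivity
  set I := Nat.log 2 Q + 1 with hI
  have hIJ : I ≤ J := by
    have h := Nat.pow_log_le_self 2 hQ0.ne'
    have : 2 ^ Nat.log 2 Q < 2 ^ J := by omega
    have := (Nat.pow_lt_pow_iff_right (by norm_num : 1 < 2)).1 this
    omega
  have hQI : Q < 2 ^ I := Nat.lt_pow_succ_log_self (by norm_num) Q
  have hIQ : 2 ^ I ≤ 2 * Q := by
    rw [hI, pow_succ]
    have := Nat.pow_log_le_self 2 hQ0.ne'
    omega
  calc ∑ r ∈ Ioc R Q, F r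
      ≤ ∑ r ∈ Ico 1 (2 ^ I), if R < r then F r else 0 := by
        rw [← sum_filter]
        refine sum_le_sum_of_subset_of_nonneg (fun r hr => ?_) fun _ _ _ => hF0 _
        rw [mem_Ioc] at hr
        rw [mem_filter, mem_Ico]
        omega
    _ = ∑ i ∈ range I, ∑ r ∈ Ico (2 ^ i) (2 ^ (i + 1)), if R < r then F r else 0 :=
        sum_Ico_one_two_pow _ _
    _ ≤ ∑ i ∈ range I, (J ^ 2 * (72 * (X / R) + 144 * (X / Real.sqrt M)) +
          J ^ 2 * (72 * Real.sqrt X) * 2 ^ i) := by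
        refine sum_le_sum fun i _ => ?_
        by_cases h : 2 ^ (i + 1) ≤ R
        · rw [sum_eq_zero]
          · positivity
          · intro r hr
            rw [mem_Ico] at hr
            rw [if_neg (by omega)]
        -- Only blocks reaching beyond R contribute, so P = 2^i may be replaced by R/2 in the term
        -- X/P.
        · have h3 : (R : ℝ) ≤ 2 * 2 ^ i := by
            rw [← pow_succ']
            exact_mod_cast (not_le.1 h).le
          calc _ ≤ ∑ r ∈ Ico (2 ^ i) (2 * 2 ^ i), F r := by
                rw [← pow_succ']
                refine sum_le_sum fun r _ => ?_
                split_ifs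
                · exact le_rfl
                · exact hF0 r
            _ ≤ _ := sum_norm_bilinearCharSum_dyadic_le hM (by positivity) hJ ha hb ha0 hb0
            _ ≤ _ := by
                push_cast
                have h4 : (X : ℝ) / 2 ^ i ≤ 2 * (X / R) := by
                  rw [← mul_div_assoc, div_le_div_iff₀ (by positivity) hR']
                  have : (0 : ℝ) ≤ X := by positivity
                  nlinarith
                have h5 : (J : ℝ) ^ 2 * (36 * (X / 2 ^ i)) ≤ J ^ 2 * (72 * (X / R)) := by
                  gcongr ?_ * ?_
                  linarith
                linarith
    _ = J ^ 2 * (I * (72 * (X / R) + 144 * (X / Real.sqrt M)) +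
          72 * Real.sqrt X * (∑ i ∈ range I, 2 ^ i)) := by
        rw [sum_add_distrib, sum_const, card_range, nsmul_eq_mul, ← mul_sum]
        ring
    _ ≤ J ^ 2 * (J * (72 * (X / R) + 144 * (X / Real.sqrt M)) +
          72 * Real.sqrt X * (2 * Q)) := by
        have h6 : ∑ i ∈ range I, (2 : ℝ) ^ i ≤ 2 * Q := by
          have h7 := Nat.geomSum_eq (le_refl 2) I
          have h8 : ∑ i ∈ range I, 2 ^ i ≤ 2 * Q := by
            rw [h7]; simp; omega
          exact_mod_cast h8
        gcongr
    _ = _ := by ring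

/-! ### Averages of 1/φ and divisor sums -/

theorem sum_Icc_inv_le (N : ℕ) : ∑ n ∈ Icc 1 N, 1 / (n : ℝ) ≤ 1 + Real.log N := by
  have h := harmonic_le_one_add_log N
  rw [harmonic_eq_sum_Icc] at h
  push_cast at h
  simpa only [one_div] using h

theorem sum_Icc_inv_sq_le (N : ℕ) : ∑ n ∈ Icc 1 N, 1 / (n : ℝ) ^ 2 ≤ 2 := by
  have h := sum_inv_sq_range_le N
  rw [range_eq_Ico, sum_Ico_add' (fun k : ℕ => 1 / ((k : ℝ)) ^ 2 ) 0 N 1 |>.symm.trans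
    (sum_congr rfl fun k _ => by push_cast; rfl) |>.symm] at h
  refine le_trans (le_of_eq (sum_congr ?_ fun _ _ => rfl)) h
  ext n
  simp only [mem_Icc, mem_Ico]
  omega

/-- Summing over `s ≤ N` and the divisors `d` of `s` amounts to summing over `d t ≤ N`. -/
theorem sum_Icc_sum_divisors {E : Type*} [AddCommMonoid E] (G : ℕ → ℕ → E) (N : ℕ) :
    ∑ s ∈ Icc 1 N, ∑ d ∈ s.divisors, G d (s / d) =
      ∑ d ∈ Icc 1 N, ∑ t ∈ Icc 1 (N / d), G d t := by
  rw [sum_sigma', sum_sigma']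
  refine sum_bij' (fun p _ => ⟨p.2, p.1 / p.2⟩) (fun p _ => ⟨p.1 * p.2, p.1⟩) ?_ ?_ ?_ ?_ ?_
  · rintro ⟨s, d⟩ h
    simp only [mem_sigma, mem_Icc, Nat.mem_divisors] at h ⊢
    have hd : 0 < d := Nat.pos_of_dvd_of_pos h.2.1 (by omega)
    have hds := Nat.le_of_dvd (by omega) h.2.1
    exact ⟨⟨hd, by omega⟩, Nat.div_pos hds hd, Nat.div_le_div_right h.1.2⟩
  · rintro ⟨d, t⟩ h
    simp only [mem_sigma, mem_Icc, Nat.mem_divisors] at h ⊢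
    have h1 : 0 < d * t := Nat.mul_pos (by omega) (by omega)
    refine ⟨⟨h1, ?_⟩, ⟨t, rfl⟩, h1.ne'⟩
    calc d * t ≤ d * (N / d) := Nat.mul_le_mul_left _ h.2.2
      _ ≤ N := Nat.mul_div_le _ _
  · rintro ⟨s, d⟩ h
    simp only [mem_sigma, mem_Icc, Nat.mem_divisors] at h ⊢
    simp only [Nat.mul_div_cancel' h.2.1]
  · rintro ⟨d, t⟩ h
    simp only [mem_sigma, mem_Icc] at h ⊢
    simp only [Nat.mul_div_cancel_left t (by omega : 0 < d)]
  · rintro ⟨s, d⟩ h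
    rfl

/-- Both sides are multiplicative, and on a power of p the divisors 1 and p alone contribute 1 +
1/(p - 1) = p/(p - 1). -/
theorem div_totient_le_sum_divisors {n : ℕ} (hn : 0 < n) :
    (n : ℝ) / Nat.totient n ≤ ∑ d ∈ n.divisors, 1 / (Nat.totient d : ℝ) := by
  induction n using Nat.recOnPosPrimePosCoprime with
  | prime_pow p k hp hk =>
    obtain ⟨k, rfl⟩ := Nat.exists_eq_succ_of_ne_zero hk.ne'
    have hp1 : (1 : ℝ) < p := by exact_mod_cast hp.one_lt
    have hsub : ({1, p} : Finset ℕ) ⊆ (p ^ (k + 1)).divisors := by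
      intro d hd
      rw [Nat.mem_divisors]
      refine ⟨?_, by positivity⟩
      rcases mem_insert.1 hd with rfl | hd
      · exact one_dvd _
      · rw [mem_singleton.1 hd]; exact dvd_pow_self p (by omega)
    refine le_trans (le_of_eq ?_)
      (sum_le_sum_of_subset_of_nonneg hsub fun _ _ _ => by positivity)
    rw [sum_pair hp.one_lt.ne, Nat.totient_prime_pow_succ hp, Nat.totient_one,
      Nat.totient_prime hp]
    push_cast [Nat.cast_sub hp.one_lt.le]
    have : (p : ℝ) - 1 ≠ 0 := by linarith
    have : (p : ℝ) ≠ 0 := by linarith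
    rw [Nat.succ_eq_add_one, pow_succ]
    field_simp
    ring
  | zero => omega
  | one => simp
  | coprime a b ha hb hab iha ihb =>
    have ha0 : 0 < a := by omega
    have hb0 : 0 < b := by omega
    rw [Nat.totient_mul hab]
    push_cast
    rw [mul_div_mul_comm]
    refine (mul_le_mul (iha ha0) (ihb hb0) (by positivity) (by positivity)).trans (le_of_eq ?_)
    have himg : (a * b).divisors = (a.divisors ×ˢ b.divisors).image fun p => p.1 * p.2 := by
      rw [Nat.divisors_mul]; rfl
    have hinj : Set.InjOn (fun p : ℕ × ℕ => p.1 * p.2) (a.divisors ×ˢ b.divisors : Finset (ℕ × ℕ)) := by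
      simpa using hab.mul_injOn_divisors
    rw [sum_mul_sum, ← sum_product', himg, sum_image hinj]
    refine sum_congr rfl fun p hp => ?_
    rw [mem_product] at hp
    rw [Nat.totient_mul (Nat.Coprime.of_dvd (Nat.dvd_of_mem_divisors hp.1)
      (Nat.dvd_of_mem_divisors hp.2) hab)]
    push_cast
    rw [div_mul_div_comm, one_mul]

/-- Inserting `div_totient_le_sum_divisors` and exchanging sums leaves ∑ 1/(d φ(d)) times a harmonic
sum. The former is at most (∑ 1/d²)² ≤ 4, by 1/φ(d) ≤ τ(d)/d with τ the number of divisors. -/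
theorem sum_inv_totient_le (N : ℕ) :
    ∑ s ∈ Icc 1 N, 1 / (Nat.totient s : ℝ) ≤ 4 * (1 + Real.log N) := by
  have hlog : 0 ≤ 1 + Real.log N := by positivity
  have h1 : ∀ s ∈ Icc 1 N, 1 / (Nat.totient s : ℝ) ≤
      1 / (s : ℝ) * ∑ d ∈ s.divisors, 1 / (Nat.totient d : ℝ) := by
    intro s hs
    have hs0 : 0 < s := (mem_Icc.1 hs).1
    have : (0 : ℝ) < s := by exact_mod_cast hs0
    calc 1 / (Nat.totient s : ℝ) = 1 / (s : ℝ) * (s / Nat.totient s) := by field_simp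
      _ ≤ _ := by gcongr; exact div_totient_le_sum_divisors hs0
  have swap : ∀ F : ℕ → ℝ, (∀ d, 0 ≤ F d) → ∀ e : ℕ,
      ∑ s ∈ Icc 1 N, 1 / (s : ℝ) ^ e * ∑ d ∈ s.divisors, F d ≤
      (∑ d ∈ Icc 1 N, F d / (d : ℝ) ^ e) * ∑ t ∈ Icc 1 N, 1 / (t : ℝ) ^ e := by
    intro F hF e
    have : ∑ s ∈ Icc 1 N, 1 / (s : ℝ) ^ e * ∑ d ∈ s.divisors, F d =
        ∑ s ∈ Icc 1 N, ∑ d ∈ s.divisors, F d / (d : ℝ) ^ e * (1 / ((s / d : ℕ) : ℝ) ^ e) := by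
      refine sum_congr rfl fun s hs => ?_
      rw [mul_sum]
      refine sum_congr rfl fun d hd => ?_
      have hd1 := Nat.dvd_of_mem_divisors hd
      have hs0 : 0 < s := (mem_Icc.1 hs).1
      have hd0 : (d : ℝ) ≠ 0 := by exact_mod_cast (Nat.pos_of_dvd_of_pos hd1 hs0).ne'
      rw [Nat.cast_div hd1 hd0]
      have : (s : ℝ) ≠ 0 := by exact_mod_cast hs0.ne'
      rw [div_pow]
      field_simp
    rw [this, sum_Icc_sum_divisors (fun d t => F d / (d : ℝ) ^ e * (1 / (t : ℝ) ^ e)), sum_mul]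
    refine sum_le_sum fun d _ => ?_
    rw [mul_sum]
    refine sum_le_sum_of_subset_of_nonneg (Icc_subset_Icc_right (Nat.div_le_self _ _))
      fun _ _ _ => mul_nonneg (div_nonneg (hF _) (by positivity)) (by positivity)
  have h2 : ∑ d ∈ Icc 1 N, 1 / (Nat.totient d : ℝ) / (d : ℝ) ^ 1 ≤ 4 := by
    calc _ ≤ ∑ s ∈ Icc 1 N, 1 / (s : ℝ) ^ 2 * ∑ d ∈ s.divisors, (1 : ℝ) := by
          refine sum_le_sum fun s hs => ?_
          have hs0 : (0 : ℝ) < s := by exact_mod_cast (mem_Icc.1 hs).1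
          rw [pow_one, pow_two, div_le_iff₀ hs0]
          refine (h1 s hs).trans ?_
          have : ∑ d ∈ s.divisors, 1 / (Nat.totient d : ℝ) ≤ ∑ d ∈ s.divisors, (1 : ℝ) := by
            refine sum_le_sum fun d hd => ?_
            have : 0 < d := Nat.pos_of_mem_divisors hd
            have : (1 : ℝ) ≤ Nat.totient d := by exact_mod_cast Nat.totient_pos.2 this
            rw [div_le_one (by linarith)]
            exact this
          calc _ ≤ 1 / (s : ℝ) * ∑ d ∈ s.divisors, (1 : ℝ) := by gcongr
            _ = _ := by field_simp
      _ ≤ (∑ d ∈ Icc 1 N, 1 / (d : ℝ) ^ 2) * ∑ t ∈ Icc 1 N, 1 / (t : ℝ) ^ 2 :=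
          swap (fun _ => 1) (fun _ => zero_le_one) 2
      _ ≤ 2 * 2 := by
          gcongr
          · exact sum_Icc_inv_sq_le N
          · exact sum_Icc_inv_sq_le N
      _ = 4 := by norm_num
  calc _ ≤ ∑ s ∈ Icc 1 N, 1 / (s : ℝ) ^ 1 * ∑ d ∈ s.divisors, 1 / (Nat.totient d : ℝ) := by
        simpa using sum_le_sum h1
    _ ≤ _ := swap _ (fun d => by positivity) 1
    _ ≤ 4 * (1 + Real.log N) := by
        gcongr
        simpa using sum_Icc_inv_le N

theorem sum_div_totient_sum_divisors_le {c : ℕ → ℝ} (hc : ∀ d, 0 ≤ c d) (N : ℕ) :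
    ∑ s ∈ Icc 1 N, 1 / (Nat.totient s : ℝ) * ∑ d ∈ s.divisors, c d ≤
      (∑ s ∈ Icc 1 N, 1 / (Nat.totient s : ℝ)) * ∑ d ∈ Icc 1 N, c d / Nat.totient d := by
  have h : ∑ s ∈ Icc 1 N, 1 / (Nat.totient s : ℝ) * ∑ d ∈ s.divisors, c d ≤
      ∑ s ∈ Icc 1 N, ∑ d ∈ s.divisors, c d / Nat.totient d * (1 / (Nat.totient (s / d) : ℝ)) := by
    refine sum_le_sum fun s hs => ?_
    rw [mul_sum]
    refine sum_le_sum fun d hd => ?_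
    have hd1 := Nat.dvd_of_mem_divisors hd
    have hs0 : 0 < s := (mem_Icc.1 hs).1
    have hd0 : 0 < d := Nat.pos_of_dvd_of_pos hd1 hs0
    have ht0 : 0 < s / d := Nat.div_pos (Nat.le_of_dvd hs0 hd1) hd0
    have h1 : (0 : ℝ) < Nat.totient d := by exact_mod_cast Nat.totient_pos.2 hd0
    have h2 : (0 : ℝ) < Nat.totient (s / d) := by exact_mod_cast Nat.totient_pos.2 ht0
    have h3 : (Nat.totient d : ℝ) * Nat.totient (s / d) ≤ Nat.totient s := by
      have := Nat.totient_super_multiplicative d (s / d)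
      rw [Nat.mul_div_cancel' hd1] at this
      exact_mod_cast this
    rw [div_mul_div_comm, mul_one, div_mul_eq_mul_div, one_mul]
    exact div_le_div_of_nonneg_left (hc d) (by positivity) h3
  refine h.trans ?_
  rw [sum_Icc_sum_divisors (fun d t => c d / Nat.totient d * (1 / (Nat.totient t : ℝ))), mul_comm,
    sum_mul]
  refine sum_le_sum fun d _ => ?_
  rw [mul_sum]
  refine sum_le_sum_of_subset_of_nonneg (Icc_subset_Icc_right (Nat.div_le_self _ _))
    fun _ _ _ => mul_nonneg (div_nonneg (hc _) (by positivity)) (by positivity)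

theorem totient_mul_le (r k : ℕ) : Nat.totient (r * k) ≤ r * Nat.totient k := by
  induction r using induction_on_primes with
  | zero => simp
  | one => simp
  | prime_mul p r hp ih =>
    have : Nat.totient (p * (r * k)) ≤ p * Nat.totient (r * k) := by
      by_cases h : p ∣ r * k
      · rw [Nat.totient_mul_of_prime_of_dvd hp h]
      · rw [Nat.totient_mul_of_prime_of_not_dvd hp h]
        exact Nat.mul_le_mul_right _ (Nat.sub_le _ _)
    rw [mul_assoc, mul_assoc]
    exact this.trans (Nat.mul_le_mul_left _ ih)

/-! ### Coprimality conditions on average and the hyperbola method -/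

/-- `∑_{n ≤ N, (n, s) = 1} G(n)`. -/
noncomputable def coprimeSum (G : ℕ → ℂ) (N s : ℕ) : ℂ :=
  ∑ n ∈ Icc 1 N, if n.Coprime s then G n else 0

/-- `μ(d) ∑_{n ≤ N, d ∣ n} G(n)`. -/
noncomputable def moebiusDvdSum (G : ℕ → ℂ) (N d : ℕ) : ℂ :=
  (ArithmeticFunction.moebius d : ℂ) * ∑ n ∈ Icc 1 N, if d ∣ n then G n else 0

theorem sum_moebius_ite_dvd {n s : ℕ} (hs : 0 < s) :
    ∑ d ∈ s.divisors, (if d ∣ n then (ArithmeticFunction.moebius d : ℂ) else 0) =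
      if n.Coprime s then 1 else 0 := by
  rw [← sum_filter]
  have h : s.divisors.filter (· ∣ n) = (n.gcd s).divisors := by
    ext d
    simp only [mem_filter, Nat.mem_divisors, Nat.dvd_gcd_iff]
    have : n.gcd s ≠ 0 := (Nat.gcd_pos_of_pos_right n hs).ne'
    constructor
    · rintro ⟨⟨h1, -⟩, h2⟩; exact ⟨⟨h2, h1⟩, this⟩
    · rintro ⟨⟨h1, h2⟩, -⟩; exact ⟨⟨h2, hs.ne'⟩, h1⟩
  rw [h]
  have h2 := congrArg (fun F : ArithmeticFunction ℤ => F (n.gcd s))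
    ArithmeticFunction.moebius_mul_coe_zeta
  simp only [ArithmeticFunction.coe_mul_zeta_apply,
    ArithmeticFunction.one_apply] at h2
  have h3 := congrArg (Int.cast : ℤ → ℂ) h2
  push_cast at h3
  exact h3

theorem sum_moebiusDvdSum (G : ℕ → ℂ) (N : ℕ) {s : ℕ} (hs : 0 < s) :
    ∑ d ∈ s.divisors, moebiusDvdSum G N d = coprimeSum G N s := by
  simp only [moebiusDvdSum, coprimeSum, mul_sum]
  rw [sum_comm]
  refine sum_congr rfl fun n _ => ?_
  have := congrArg (· * G n) (sum_moebius_ite_dvd (n := n) hs)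
  simp only [sum_mul, ite_mul, zero_mul, one_mul] at this
  rw [← this]
  exact sum_congr rfl fun d _ => by split_ifs <;> simp

theorem norm_moebius_le_one (d : ℕ) : ‖(ArithmeticFunction.moebius d : ℂ)‖ ≤ 1 := by
  rw [Complex.norm_intCast]
  exact_mod_cast ArithmeticFunction.abs_moebius_le_one

theorem norm_moebiusDvdSum_le {G : ℕ → ℂ} (hG : ∀ n, ‖G n‖ ≤ 1) (N : ℕ) (d : ℕ) :
    ‖moebiusDvdSum G N d‖ ≤ N / d := by
  rw [moebiusDvdSum, norm_mul]
  refine (mul_le_of_le_one_left (norm_nonneg _) (norm_moebius_le_one d)).trans ?_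
  rw [← sum_filter]
  refine (norm_sum_le _ _).trans ((sum_le_sum fun n _ => hG n).trans ?_)
  rw [sum_const, nsmul_eq_mul, mul_one]
  have : ((Icc 1 N).filter (d ∣ ·)).card = N / d := by
    rw [← Nat.Ioc_filter_dvd_card_eq_div]
    rfl
  rw [this]
  exact Nat.cast_div_le

/-- Möbius inversion of `sum_moebiusDvdSum` over the divisors of d; the losses φ(k) over k ∣ d add
up to exactly d. -/
theorem norm_moebiusDvdSum_le_of_coprimeSum {G : ℕ → ℂ} {N : ℕ} {δ : ℝ}
    (h : ∀ k, 1 ≤ k → ‖coprimeSum G N k‖ ≤ δ * Nat.totient k) {d : ℕ} (hd : 0 < d) :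
    ‖moebiusDvdSum G N d‖ ≤ δ * d := by
  have h1 := (ArithmeticFunction.sum_eq_iff_sum_mul_moebius_eq
    (f := moebiusDvdSum G N) (g := coprimeSum G N)).1
    (fun n hn => sum_moebiusDvdSum G N hn) d hd
  rw [← h1]
  refine (norm_sum_le _ _).trans ?_
  calc _ ≤ ∑ p ∈ d.divisorsAntidiagonal, δ * Nat.totient p.2 := by
        refine sum_le_sum fun p hp => ?_
        rw [norm_mul]
        refine (mul_le_of_le_one_left (norm_nonneg _) (norm_moebius_le_one _)).trans (h _ ?_)
        exact Nat.pos_of_mem_divisors (Nat.snd_mem_divisors_of_mem_antidiagonal hp)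
    _ = δ * d := by
        rw [← mul_sum, Nat.sum_divisorsAntidiagonal' (fun _ j => (Nat.totient j : ℝ)),
          ← Nat.cast_sum, Nat.sum_totient]

/-- Average over `s` of the sums restricted by the condition `(n, s) = 1`. -/
theorem sum_norm_coprimeSum_le {G : ℕ → ℂ} (hG : ∀ n, ‖G n‖ ≤ 1) {N S z : ℕ} {X ε Φ : ℝ}
    (hz : 0 < z) (hε : 0 ≤ ε) (hNX : N ≤ X)
    (hΦ : ∑ s ∈ Icc 1 S, 1 / (Nat.totient s : ℝ) ≤ Φ)
    (h : ∀ k, 1 ≤ k → ‖coprimeSum G N k‖ ≤ ε * Nat.totient k * X) :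
    ∑ s ∈ Icc 1 S, 1 / (Nat.totient s : ℝ) * ‖coprimeSum G N s‖ ≤
      Φ * (ε * z ^ 2 + Φ / z) * X := by
  have hX : 0 ≤ X := le_trans (by positivity) hNX
  have hΦ0 : 0 ≤ Φ := le_trans (by positivity) hΦ
  have hz' : (0 : ℝ) < z := by exact_mod_cast hz
  set c : ℕ → ℝ := fun d => ‖moebiusDvdSum G N d‖ with hc
  have h1 : ∑ s ∈ Icc 1 S, 1 / (Nat.totient s : ℝ) * ‖coprimeSum G N s‖ ≤
      ∑ s ∈ Icc 1 S, 1 / (Nat.totient s : ℝ) * ∑ d ∈ s.divisors, c d := by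
    refine sum_le_sum fun s hs => ?_
    rw [← sum_moebiusDvdSum G N (mem_Icc.1 hs).1]
    gcongr
    exact norm_sum_le _ _
  -- Divisors up to z use the hypothesis; beyond z the number of multiples of d up to N is at most
  -- X/z.
  have h2 : ∀ d ∈ Icc 1 S, c d / Nat.totient d ≤
      (if d ∈ Icc 1 z then ε * X * z else 0) + X / z * (1 / (Nat.totient d : ℝ)) := by
    intro d hd
    have hd0 : 0 < d := (mem_Icc.1 hd).1
    have hφ : (1 : ℝ) ≤ Nat.totient d := by exact_mod_cast Nat.totient_pos.2 hd0
    by_cases hdz : d ≤ z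
    · rw [if_pos (mem_Icc.2 ⟨hd0, hdz⟩)]
      have h3 : c d ≤ ε * X * d := norm_moebiusDvdSum_le_of_coprimeSum
        (fun k hk => (h k hk).trans (le_of_eq (by ring))) hd0
      have h4 : c d / Nat.totient d ≤ c d := div_le_self (norm_nonneg _) hφ
      have h5 : (d : ℝ) ≤ z := by exact_mod_cast hdz
      have h6 : ε * X * d ≤ ε * X * z := by gcongr
      have h7 : 0 ≤ X / z * (1 / (Nat.totient d : ℝ)) := by positivity
      linarith
    · have : ¬ d ∈ Icc 1 z := fun h => hdz (mem_Icc.1 h).2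
      rw [if_neg this, zero_add, mul_one_div]
      gcongr
      refine (norm_moebiusDvdSum_le hG N d).trans ?_
      have h5 : (z : ℝ) ≤ d := by exact_mod_cast (not_le.1 hdz).le
      gcongr
  have h3 : ∑ d ∈ Icc 1 S, c d / Nat.totient d ≤ (ε * z ^ 2 + Φ / z) * X := by
    refine (sum_le_sum h2).trans ?_
    rw [sum_add_distrib, ← mul_sum, ← sum_filter, sum_const, nsmul_eq_mul]
    have h4 : ((((Icc 1 S).filter (· ∈ Icc 1 z)).card : ℕ) : ℝ) ≤ z := by
      have : ((Icc 1 S).filter (· ∈ Icc 1 z)).card ≤ (Icc 1 z).card :=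
        card_le_card fun d hd => (mem_filter.1 hd).2
      simpa using this
    calc _ ≤ (z : ℝ) * (ε * X * z) + X / z * Φ := by gcongr
      _ = _ := by ring
  calc _ ≤ _ := h1.trans (sum_div_totient_sum_divisors_le (fun d => norm_nonneg _) S)
    _ ≤ Φ * ((ε * z ^ 2 + Φ / z) * X) := by
        refine mul_le_mul hΦ h3 ?_ hΦ0
        exact sum_nonneg fun d _ => div_nonneg (norm_nonneg _) (by positivity)
    _ = _ := by ring

/-- Dirichlet's hyperbola identity. -/
theorem sum_hyperbola {X Y : ℕ} (hY : Y * Y ≤ X) (hX : X < (Y + 1) * (Y + 1)) (a b : ℕ → ℂ) :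
    ∑ m ∈ Icc 1 X, ∑ n ∈ Icc 1 (X / m), a m * b n =
      ∑ m ∈ Icc 1 Y, a m * ∑ n ∈ Icc 1 (X / m), b n +
        ∑ n ∈ Icc 1 Y, b n * (∑ m ∈ Icc 1 (X / n), a m - ∑ m ∈ Icc 1 Y, a m) := by
  have hYX : Y ≤ X := (Nat.le_mul_self Y).trans hY
  have h1 : Icc 1 X = Icc 1 Y ∪ Ioc Y X := by
    ext; simp only [mem_union, mem_Icc, mem_Ioc]; omega
  have hd : ∀ Z, Disjoint (Icc 1 Y) (Ioc Y Z) := fun Z => by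
    rw [disjoint_left]; intro m; simp only [mem_Icc, mem_Ioc]; omega
  rw [h1, sum_union (hd X)]
  congr 1
  · exact sum_congr rfl fun m _ => (mul_sum _ _ _).symm
  · have h2 : ∀ n ∈ Icc 1 Y, ∑ m ∈ Icc 1 (X / n), a m - ∑ m ∈ Icc 1 Y, a m =
        ∑ m ∈ Ioc Y (X / n), a m := by
      intro n hn
      rw [mem_Icc] at hn
      have : Y ≤ X / n := (Nat.le_div_iff_mul_le (by omega)).2
        ((Nat.mul_le_mul_left _ hn.2).trans hY)
      have h3 : Icc 1 (X / n) = Icc 1 Y ∪ Ioc Y (X / n) := by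
        ext; simp only [mem_union, mem_Icc, mem_Ioc]; omega
      rw [h3, sum_union (hd _), add_sub_cancel_left]
    have h3 : ∑ n ∈ Icc 1 Y, b n * (∑ m ∈ Icc 1 (X / n), a m - ∑ m ∈ Icc 1 Y, a m) =
        ∑ n ∈ Icc 1 Y, ∑ m ∈ Ioc Y (X / n), b n * a m :=
      sum_congr rfl fun n hn => by rw [h2 n hn, mul_sum]
    rw [h3, sum_sigma', sum_sigma']
    refine sum_bij' (fun p _ => ⟨p.2, p.1⟩) (fun p _ => ⟨p.2, p.1⟩) ?_ ?_ ?_ ?_ ?_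
    · rintro ⟨m, n⟩ h
      simp only [mem_sigma, mem_Icc, mem_Ioc] at h ⊢
      have h4 : n * m ≤ X := (Nat.le_div_iff_mul_le (by omega)).1 h.2.2
      have h5 : m ≤ X / n := (Nat.le_div_iff_mul_le (by omega)).2 (by linarith)
      -- Both variables cannot exceed Y, since X < (Y + 1)².
      refine ⟨⟨h.2.1, ?_⟩, h.1.1, h5⟩
      by_contra hc
      nlinarith
    · rintro ⟨n, m⟩ h
      simp only [mem_sigma, mem_Icc, mem_Ioc] at h ⊢
      have h4 : m * n ≤ X := (Nat.le_div_iff_mul_le (by omega)).1 h.2.2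
      have h5 : n ≤ X / m := (Nat.le_div_iff_mul_le (by omega)).2 (by linarith)
      exact ⟨⟨h.2.1, h.2.2.trans (Nat.div_le_self _ _)⟩, h.1.1, h5⟩
    · rintro ⟨m, n⟩ h; rfl
    · rintro ⟨m, n⟩ h; rfl
    · rintro ⟨m, n⟩ h; exact mul_comm _ _

/-- The restriction of `F` to the integers exceeding `M` and coprime to `s`. -/
noncomputable def truncCoprime (F : ℕ → ℂ) (M s n : ℕ) : ℂ :=
  if M < n ∧ n.Coprime s then F n else 0

theorem norm_truncCoprime_le {F : ℕ → ℂ} (hF : ∀ n, ‖F n‖ ≤ 1) (M s n : ℕ) :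
    ‖truncCoprime F M s n‖ ≤ 1 := by
  unfold truncCoprime; split_ifs
  · exact hF n
  · simp

theorem norm_sum_truncCoprime_le {F : ℕ → ℂ} (hF : ∀ n, ‖F n‖ ≤ 1) (M s N : ℕ) :
    ‖∑ n ∈ Icc 1 N, truncCoprime F M s n‖ ≤ ‖coprimeSum F N s‖ + M := by
  have h : ∑ n ∈ Icc 1 N, truncCoprime F M s n = coprimeSum F N s -
      ∑ n ∈ (Icc 1 N).filter (· ≤ M), if n.Coprime s then F n else 0 := by
    rw [coprimeSum, sum_filter, ← sum_sub_distrib]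
    refine sum_congr rfl fun n _ => ?_
    unfold truncCoprime
    by_cases h1 : M < n
    · simp [h1, not_le.2 h1]
    · simp [h1, not_lt.1 h1]
  rw [h]
  refine (norm_sub_le _ _).trans (add_le_add le_rfl ((norm_sum_le _ _).trans ?_))
  calc _ ≤ ∑ n ∈ Icc 1 M, (1 : ℝ) := by
        refine (sum_le_sum (g := fun _ => (1 : ℝ)) fun n _ => ?_).trans
          (sum_le_sum_of_subset_of_nonneg ?_ fun _ _ _ => zero_le_one)
        · split_ifs
          · exact hF n
          · simp
        · intro n hn
          simp only [mem_filter, mem_Icc] at hn ⊢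
          omega
    _ = M := by simp

/-- The hyperbola identity leaves three one-variable sums for each index up to Y, and removing the
truncation at M from each costs at most M. -/
theorem norm_sum_truncCoprime_hyperbola_le {F G : ℕ → ℂ} (hF : ∀ n, ‖F n‖ ≤ 1)
    (hG : ∀ n, ‖G n‖ ≤ 1) {X Y : ℕ} (hY : Y * Y ≤ X) (hX : X < (Y + 1) * (Y + 1)) (M s : ℕ) :
    ‖∑ m ∈ Icc 1 X, ∑ n ∈ Icc 1 (X / m), truncCoprime F M s m * truncCoprime G M s n‖ ≤
      ∑ m ∈ Icc 1 Y, (‖coprimeSum G (X / m) s‖ + ‖coprimeSum F (X / m) s‖ +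
        ‖coprimeSum F Y s‖ + 3 * M) := by
  rw [sum_hyperbola hY hX]
  refine (norm_add_le _ _).trans ?_
  refine (add_le_add (norm_sum_le _ _) (norm_sum_le _ _)).trans ?_
  rw [← sum_add_distrib]
  refine sum_le_sum fun m _ => ?_
  rw [norm_mul, norm_mul]
  have h1 := norm_sum_truncCoprime_le hG M s (X / m)
  have h2 := norm_sum_truncCoprime_le hF M s (X / m)
  have h3 := norm_sum_truncCoprime_le hF M s Y
  have h4 := norm_sub_le (∑ k ∈ Icc 1 (X / m), truncCoprime F M s k)
    (∑ k ∈ Icc 1 Y, truncCoprime F M s k)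
  have h5 := mul_le_of_le_one_left (norm_nonneg (∑ n ∈ Icc 1 (X / m), truncCoprime G M s n))
    (norm_truncCoprime_le hF M s m)
  have h6 := mul_le_of_le_one_left (norm_nonneg (∑ k ∈ Icc 1 (X / m), truncCoprime F M s k -
    ∑ k ∈ Icc 1 Y, truncCoprime F M s k)) (norm_truncCoprime_le hG M s m)
  linarith

/-- Bilinear sums restricted to integers coprime to `s`, on average over `s`, for functions which
have small sums over the integers coprime to small moduli. -/
theorem sum_norm_sum_truncCoprime_le {F G : ℕ → ℂ} (hF : ∀ n, ‖F n‖ ≤ 1) (hG : ∀ n, ‖G n‖ ≤ 1)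
    {x ε Φ : ℝ} {S z M : ℕ} (hx : 1 ≤ x) (hz : 0 < z) (hε : 0 ≤ ε)
    (hΦ : ∑ s ∈ Icc 1 S, 1 / (Nat.totient s : ℝ) ≤ Φ)
    (hFε : ∀ y, Real.sqrt x ≤ y → y ≤ x → ∀ k, 1 ≤ k →
      ‖coprimeSum F ⌊y⌋₊ k‖ ≤ ε * Nat.totient k * y)
    (hGε : ∀ y, Real.sqrt x ≤ y → y ≤ x → ∀ k, 1 ≤ k →
      ‖coprimeSum G ⌊y⌋₊ k‖ ≤ ε * Nat.totient k * y) :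
    ∑ s ∈ Icc 1 S, 1 / (Nat.totient s : ℝ) *
      ‖∑ m ∈ Icc 1 ⌊x⌋₊, ∑ n ∈ Icc 1 (⌊x⌋₊ / m), truncCoprime F M s m * truncCoprime G M s n‖ ≤
      Φ * (ε * z ^ 2 + Φ / z) * (x * (3 + 2 * Real.log x)) + 3 * M * Real.sqrt x * Φ := by
  set X := ⌊x⌋₊ with hX
  set Y := ⌊Real.sqrt x⌋₊ with hY
  set E := Φ * (ε * z ^ 2 + Φ / z) with hE
  have hx0 : 0 ≤ x := by linarith
  have hs1 : 1 ≤ Real.sqrt x := Real.one_le_sqrt.2 hx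
  have hss : Real.sqrt x * Real.sqrt x = x := Real.mul_self_sqrt hx0
  have hYs : (Y : ℝ) ≤ Real.sqrt x := Nat.floor_le (by linarith)
  have hYs' : Real.sqrt x < Y + 1 := Nat.lt_floor_add_one _
  have hXx : (X : ℝ) ≤ x := Nat.floor_le hx0
  have hΦ0 : 0 ≤ Φ := le_trans (by positivity) hΦ
  have hz' : (0 : ℝ) < z := by exact_mod_cast hz
  have hE0 : 0 ≤ E := by positivity
  have hYY : Y * Y ≤ X := by
    rw [hX]
    refine Nat.le_floor ?_
    push_cast
    nlinarith
  have hXY : X < (Y + 1) * (Y + 1) := by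
    have : (X : ℝ) < (Y + 1) * (Y + 1) := by nlinarith
    exact_mod_cast this
  have avg : ∀ H : ℕ → ℂ, (∀ n, ‖H n‖ ≤ 1) → (∀ y, Real.sqrt x ≤ y → y ≤ x → ∀ k, 1 ≤ k →
      ‖coprimeSum H ⌊y⌋₊ k‖ ≤ ε * Nat.totient k * y) → ∀ y, Real.sqrt x ≤ y → y ≤ x →
      ∑ s ∈ Icc 1 S, 1 / (Nat.totient s : ℝ) * ‖coprimeSum H ⌊y⌋₊ s‖ ≤ E * y :=
    fun H hH h y hy hy' => sum_norm_coprimeSum_le hH hz hε (Nat.floor_le (by linarith)) hΦ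
      (h y hy hy')
  -- For m ≤ √x the inner length x/m is still at least √x, so the hypotheses apply to it.
  have hYle : ∀ m ∈ Icc 1 Y, Real.sqrt x ≤ x / m ∧ x / m ≤ x ∧ ⌊x / m⌋₊ = X / m := by
    intro m hm
    rw [mem_Icc] at hm
    have hm1 : (1 : ℝ) ≤ m := by exact_mod_cast hm.1
    have hm2 : (m : ℝ) ≤ Real.sqrt x := le_trans (by exact_mod_cast hm.2) hYs
    refine ⟨?_, div_le_self hx0 hm1, Nat.floor_div_natCast x m⟩
    rw [le_div_iff₀ (by linarith)]
    nlinarith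
  calc _ ≤ ∑ s ∈ Icc 1 S, 1 / (Nat.totient s : ℝ) *
        ∑ m ∈ Icc 1 Y, (‖coprimeSum G (X / m) s‖ + ‖coprimeSum F (X / m) s‖ +
          ‖coprimeSum F Y s‖ + 3 * M) := by
        refine sum_le_sum fun s _ => ?_
        gcongr
        exact norm_sum_truncCoprime_hyperbola_le hF hG hYY hXY M s
    _ = ∑ m ∈ Icc 1 Y, (∑ s ∈ Icc 1 S, 1 / (Nat.totient s : ℝ) * ‖coprimeSum G (X / m) s‖ +
          ∑ s ∈ Icc 1 S, 1 / (Nat.totient s : ℝ) * ‖coprimeSum F (X / m) s‖ +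
          ∑ s ∈ Icc 1 S, 1 / (Nat.totient s : ℝ) * ‖coprimeSum F Y s‖ +
          3 * M * ∑ s ∈ Icc 1 S, 1 / (Nat.totient s : ℝ)) := by
        simp only [mul_sum]
        rw [sum_comm]
        refine sum_congr rfl fun m _ => ?_
        simp only [← sum_add_distrib]
        exact sum_congr rfl fun s _ => by ring
    _ ≤ ∑ m ∈ Icc 1 Y, (2 * E * x * (1 / (m : ℝ)) + (E * Real.sqrt x + 3 * M * Φ)) := by
        refine sum_le_sum fun m hm => ?_
        obtain ⟨h1, h2, h3⟩ := hYle m hm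
        have a1 := avg G hG hGε _ h1 h2
        have a2 := avg F hF hFε _ h1 h2
        have a3 := avg F hF hFε (Real.sqrt x) le_rfl (by nlinarith)
        rw [h3] at a1 a2
        have a4 : 3 * (M : ℝ) * ∑ s ∈ Icc 1 S, 1 / (Nat.totient s : ℝ) ≤ 3 * M * Φ := by gcongr
        have a5 : 2 * E * x * (1 / (m : ℝ)) = E * (x / m) + E * (x / m) := by ring
        rw [a5]
        linarith
    _ = 2 * E * x * (∑ m ∈ Icc 1 Y, 1 / (m : ℝ)) + Y * (E * Real.sqrt x + 3 * M * Φ) := by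
        rw [sum_add_distrib, ← mul_sum, sum_const, nsmul_eq_mul, Nat.card_Icc]
        simp
    _ ≤ 2 * E * x * (1 + Real.log x) + Real.sqrt x * (E * Real.sqrt x + 3 * M * Φ) := by
        have hY1 : 1 ≤ Y := Nat.le_floor (by simpa using hs1)
        have : Real.log Y ≤ Real.log x :=
          Real.log_le_log (by exact_mod_cast hY1) (by nlinarith)
        have h1 := (sum_Icc_inv_le Y).trans (add_le_add le_rfl this)
        gcongr
    _ = E * (Real.sqrt x * Real.sqrt x) + 2 * E * x * (1 + Real.log x) +
        3 * M * Real.sqrt x * Φ := by ring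
    _ = _ := by rw [hss]; ring

/-! ### Orthogonality, the kernel of Δ_Ξ and induced characters -/

theorem conj_apply_unit {q : ℕ} (χ : DirichletCharacter ℂ q) (v : (ZMod q)ˣ) :
    (starRingEnd ℂ) (χ v) = χ ((v⁻¹ : (ZMod q)ˣ) : ZMod q) := by
  rw [starRingEnd_apply, MulChar.star_apply', MulChar.inv_apply, Ring.inverse_unit]

theorem sum_units_eq_sum {q : ℕ} [NeZero q] {F : ZMod q → ℂ} (hF : ∀ b, ¬ IsUnit b → F b = 0) :
    ∑ u : (ZMod q)ˣ, F u = ∑ b : ZMod q, F b := by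
  classical
  refine sum_of_injOn (fun u : (ZMod q)ˣ => (u : ZMod q)) (Units.val_injective.injOn)
    (fun _ _ => by simp) ?_ fun _ _ => rfl
  intro b _ hb
  exact hF b fun h => hb ⟨h.unit, by simp, by simp⟩

theorem sum_mul_conj_apply {q : ℕ} [NeZero q] (a : (ZMod q)ˣ) (b : ZMod q) :
    ∑ χ : DirichletCharacter ℂ q, χ a * (starRingEnd ℂ) (χ b) =
      if b = a then (Nat.totient q : ℂ) else 0 := by
  have h := congrArg (starRingEnd ℂ) (DirichletCharacter.sum_char_inv_mul_char_eq ℂ a.isUnit b)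
  rw [map_sum] at h
  rw [sum_congr rfl fun χ _ => ?_, h]
  · by_cases hab : (a : ZMod q) = b
    · simp [hab]
    · simp [hab, Ne.symm hab]
  · rw [map_mul, ZMod.inv_coe_unit, conj_apply_unit, inv_inv]

theorem sum_units_conj_mul_apply {q : ℕ} [NeZero q] (χ χ' : DirichletCharacter ℂ q) :
    ∑ u : (ZMod q)ˣ, (starRingEnd ℂ) (χ u) * χ' u =
      if χ' = χ then (Nat.totient q : ℂ) else 0 := by
  have h : ∀ u : (ZMod q)ˣ, (starRingEnd ℂ) (χ u) * χ' u = (χ⁻¹ * χ') u := fun u => by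
    rw [MulChar.mul_apply, starRingEnd_apply, MulChar.star_apply']
  simp only [h]
  split_ifs with hχ
  · subst hχ
    rw [inv_mul_cancel]
    simp [ZMod.card_units_eq_totient]
  · rw [sum_units_eq_sum (F := fun b => (χ⁻¹ * χ') b) fun b hb => MulChar.map_nonunit _ hb]
    refine MulChar.sum_eq_zero_of_ne_one fun h1 => hχ ?_
    exact (inv_mul_eq_one.1 h1).symm

open Classical in
/-- The characters mod `q` that are not induced by a character in `Ξ`. -/
noncomputable def nonInducedChars (Ξ : Set (Σ r : ℕ, DirichletCharacter ℂ r)) (q : ℕ) :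
    Finset (DirichletCharacter ℂ q) :=
  univ.filter fun χ => χ ∉ inducedChars Ξ q

open Classical in
/-- The primitive characters mod `r` that do not belong to `Ξ`. -/
noncomputable def primitiveCharsOutside (Ξ : Set (Σ r : ℕ, DirichletCharacter ℂ r)) (r : ℕ) :
    Finset (DirichletCharacter ℂ r) :=
  (primitiveChars r).filter fun ψ => (⟨r, ψ⟩ : Σ r : ℕ, DirichletCharacter ℂ r) ∉ Ξ

theorem primitiveCharsOutside_subset (Ξ : Set (Σ r : ℕ, DirichletCharacter ℂ r)) (r : ℕ) :
    primitiveCharsOutside Ξ r ⊆ primitiveChars r := by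
  classical
  exact filter_subset _ _

/-- The kernel of `Δ_Ξ( · ; q, a)`: the normalised sum of `χ(a) conj(χ(n))` over the characters
`χ` mod `q` that are not induced by a character in `Ξ`. -/
noncomputable def deltaKernel (Ξ : Set (Σ r : ℕ, DirichletCharacter ℂ r)) (q : ℕ) (a : ZMod q)
    (n : ZMod q) : ℂ :=
  1 / (Nat.totient q : ℂ) * ∑ χ ∈ nonInducedChars Ξ q, χ a * (starRingEnd ℂ) (χ n)

section

variable {Ξ : Set (Σ r : ℕ, DirichletCharacter ℂ r)}

theorem card_le_totient {q : ℕ} [NeZero q] (s : Finset (DirichletCharacter ℂ q)) :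
    s.card ≤ Nat.totient q := by
  rw [← DirichletCharacter.card_eq_totient_of_hasEnoughRootsOfUnity ℂ q, Nat.card_eq_fintype_card]
  exact card_le_univ s

theorem norm_deltaKernel_le {q : ℕ} [NeZero q] (a n : ZMod q) : ‖deltaKernel Ξ q a n‖ ≤ 1 := by
  have hφ : (0 : ℝ) < Nat.totient q := by exact_mod_cast Nat.totient_pos.2 (NeZero.pos q)
  rw [deltaKernel, norm_mul, norm_div, norm_one, Complex.norm_natCast, div_mul_eq_mul_div, one_mul,
    div_le_one hφ]
  refine (norm_sum_le _ _).trans ?_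
  calc _ ≤ ∑ χ ∈ nonInducedChars Ξ q, (1 : ℝ) := by
        refine sum_le_sum fun χ _ => ?_
        rw [norm_mul, RCLike.norm_conj]
        exact mul_le_one₀ (χ.norm_le_one a) (norm_nonneg _) (χ.norm_le_one n)
    _ ≤ _ := by
        rw [sum_const, nsmul_eq_mul, mul_one]
        exact_mod_cast card_le_totient _

/-- The sum over all characters mod q detects n ≡ a, and the subtracted main term removes precisely
those in Ξ_q. -/
theorem DeltaXi_eq_sum_charSum {q : ℕ} [NeZero q] (h : ArithmeticFunction ℂ) (X : ℝ)
    (a : (ZMod q)ˣ) : DeltaXi Ξ h X q a =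
      1 / (Nat.totient q : ℂ) * ∑ χ ∈ nonInducedChars Ξ q, χ a * charSum h X χ := by
  classical
  have hφ : (Nat.totient q : ℂ) ≠ 0 := by exact_mod_cast (Nat.totient_pos.2 (NeZero.pos q)).ne'
  have h1 : ∑ n ∈ (Icc 1 ⌊X⌋₊).filter (fun n : ℕ => (n : ZMod q) = a), h n =
      1 / (Nat.totient q : ℂ) * ∑ χ : DirichletCharacter ℂ q, χ a * charSum h X χ := by
    simp only [charSum, mul_sum]
    rw [sum_comm, sum_filter]
    refine sum_congr rfl fun n _ => ?_
    have : ∑ χ : DirichletCharacter ℂ q, 1 / (Nat.totient q : ℂ) *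
        (χ a * (h n * (starRingEnd ℂ) (χ (n : ZMod q)))) =
        1 / (Nat.totient q : ℂ) * h n *
          ∑ χ : DirichletCharacter ℂ q, χ a * (starRingEnd ℂ) (χ (n : ZMod q)) := by
      rw [mul_sum]
      exact sum_congr rfl fun χ _ => by ring
    rw [this, sum_mul_conj_apply]
    split_ifs
    · field_simp
    · simp
  have h2 : ∑ᶠ χ ∈ inducedChars Ξ q, χ (a : ZMod q) * charSum h X χ =
      ∑ χ ∈ univ.filter fun χ => ¬ χ ∉ inducedChars Ξ q, χ a * charSum h X χ := by
    rw [finsum_mem_eq_finite_toFinset_sum _ (inducedChars_finite Ξ q)]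
    refine sum_congr ?_ fun _ _ => rfl
    ext χ
    simp
  rw [DeltaXi, h2, nonInducedChars]
  have h3 := sum_filter_add_sum_filter_not (univ : Finset (DirichletCharacter ℂ q))
    (fun χ => χ ∉ inducedChars Ξ q) fun χ => χ a * charSum h X χ
  convert sub_eq_iff_eq_add.2 ?_ using 1
  rw [← mul_add, h3]
  convert h1

theorem DeltaXi_eq_sum_deltaKernel {q : ℕ} [NeZero q] (h : ArithmeticFunction ℂ) (X : ℝ)
    (a : (ZMod q)ˣ) : DeltaXi Ξ h X q a =
      ∑ n ∈ Icc 1 ⌊X⌋₊, h n * deltaKernel Ξ q a (n : ZMod q) := by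
  rw [DeltaXi_eq_sum_charSum]
  simp only [charSum, deltaKernel, mul_sum]
  rw [sum_comm]
  exact sum_congr rfl fun n _ => sum_congr rfl fun χ _ => by ring

/-- This is what lets a fixed factor m of mn be absorbed into the residue class. -/
theorem deltaKernel_unit_mul {q : ℕ} (a u : (ZMod q)ˣ) (n : ZMod q) :
    deltaKernel Ξ q a (u * n) = deltaKernel Ξ q ((a * u⁻¹ : (ZMod q)ˣ) : ZMod q) n := by
  simp only [deltaKernel]
  congr 1
  refine sum_congr rfl fun χ _ => ?_
  rw [map_mul, map_mul, conj_apply_unit, Units.val_mul, map_mul]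
  ring

theorem deltaKernel_mul_of_not_isUnit {q : ℕ} (a : ZMod q) {m : ZMod q} (hm : ¬ IsUnit m)
    (n : ZMod q) : deltaKernel Ξ q a (m * n) = 0 := by
  rw [deltaKernel, sum_eq_zero, mul_zero]
  intro χ _
  rw [map_mul, χ.map_nonunit hm]
  simp

/-- Fourier inversion on the unit group: a character outside Ξ_q survives in Δ_Ξ, so its sum is
recovered from the values of Δ_Ξ. -/
theorem charSum_eq_sum_units {q : ℕ} [NeZero q] (h : ArithmeticFunction ℂ) (X : ℝ)
    {χ : DirichletCharacter ℂ q} (hχ : χ ∈ nonInducedChars Ξ q) :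
    charSum h X χ = ∑ u : (ZMod q)ˣ, (starRingEnd ℂ) (χ u) * DeltaXi Ξ h X q u := by
  classical
  have hφ : (Nat.totient q : ℂ) ≠ 0 := by exact_mod_cast (Nat.totient_pos.2 (NeZero.pos q)).ne'
  simp only [DeltaXi_eq_sum_charSum, mul_sum]
  rw [sum_comm]
  have : ∀ χ' : DirichletCharacter ℂ q, ∑ u : (ZMod q)ˣ, (starRingEnd ℂ) (χ u) *
      (1 / (Nat.totient q : ℂ) * (χ' u * charSum h X χ')) =
      if χ' = χ then charSum h X χ' else 0 := by
    intro χ'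
    calc _ = 1 / (Nat.totient q : ℂ) * charSum h X χ' *
          ∑ u : (ZMod q)ˣ, (starRingEnd ℂ) (χ u) * χ' u := by
          rw [mul_sum]; exact sum_congr rfl fun u _ => by ring
      _ = _ := by
          rw [sum_units_conj_mul_apply]
          split_ifs
          · field_simp
          · simp
  simp only [this, sum_ite_eq', hχ, if_true]

theorem norm_charSum_le {q : ℕ} [NeZero q] {h : ArithmeticFunction ℂ} {X δ : ℝ}
    {χ : DirichletCharacter ℂ q} (hχ : χ ∈ nonInducedChars Ξ q)
    (hδ : ∀ a : (ZMod q)ˣ, ‖DeltaXi Ξ h X q a‖ ≤ δ) :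
    ‖charSum h X χ‖ ≤ Nat.totient q * δ := by
  rw [charSum_eq_sum_units h X hχ]
  refine (norm_sum_le _ _).trans ?_
  calc _ ≤ ∑ u : (ZMod q)ˣ, δ := by
        refine sum_le_sum fun u _ => ?_
        rw [norm_mul, RCLike.norm_conj, DirichletCharacter.unit_norm_eq_one, one_mul]
        exact hδ u
    _ = _ := by simp [ZMod.card_units_eq_totient]

theorem changeLevel_mul_natCast {r : ℕ} (s : ℕ) [NeZero (r * s)] (ψ : DirichletCharacter ℂ r)
    (n : ℕ) : DirichletCharacter.changeLevel (Dvd.intro s rfl : r ∣ r * s) ψ (n : ZMod (r * s)) =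
      if n.Coprime s then ψ (n : ZMod r) else 0 := by
  by_cases h : n.Coprime (r * s)
  · have h1 := Nat.isCoprime_iff_coprime.2 h
    have h2 := DirichletCharacter.changeLevel_eq_cast_of_dvd' ψ (Dvd.intro s rfl : r ∣ r * s)
      (a := (n : ℤ)) (by exact_mod_cast h1)
    push_cast at h2
    rw [h2, if_pos (Nat.Coprime.coprime_mul_left_right h)]
  · rw [MulChar.map_nonunit _ (by rwa [ZMod.isUnit_iff_coprime])]
    split_ifs with hs
    · rw [MulChar.map_nonunit]
      rw [ZMod.isUnit_iff_coprime]
      exact fun hr => h (Nat.Coprime.mul_right hr hs)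
    · rfl

/-- Induction preserves the conductor, and ψ and the members of Ξ are primitive. If ψ and some ξ in
Ξ induced the same character, their moduli would agree, and then ψ = ξ by injectivity of
`changeLevel`. -/
theorem changeLevel_mem_nonInducedChars (hΞ : IsPrimitiveCharSet Ξ) {r q : ℕ} [NeZero q]
    (hrq : r ∣ q) {ψ : DirichletCharacter ℂ r} (hψ : ψ ∈ primitiveCharsOutside Ξ r) :
    DirichletCharacter.changeLevel hrq ψ ∈ nonInducedChars Ξ q := by
  classical
  simp only [primitiveCharsOutside, mem_filter, mem_primitiveChars] at hψ
  simp only [nonInducedChars, mem_filter, mem_univ, true_and]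
  rintro ⟨⟨r', ξ⟩, hξ, hd, he⟩
  have h1 := congrArg DirichletCharacter.conductor he
  rw [DirichletCharacter.conductor_changeLevel, DirichletCharacter.conductor_changeLevel,
    (DirichletCharacter.isPrimitive_def _).1 hψ.1,
    (DirichletCharacter.isPrimitive_def _).1 (hΞ _ hξ).2] at h1
  dsimp only at h1 hd ξ he
  subst h1
  have := DirichletCharacter.changeLevel_injective hd he
  subst this
  exact hψ.2 hξ

/-- Sums over the characters not induced by `Ξ`, in terms of the primitive characters outside
`Ξ`. -/
theorem sum_nonInducedChars_le {q : ℕ} [NeZero q] {H : DirichletCharacter ℂ q → ℝ}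
    {T : ∀ r : ℕ, DirichletCharacter ℂ r → ℝ} (hT : ∀ r ψ, 0 ≤ T r ψ)
    (hHT : ∀ (r : ℕ) (h : r ∣ q) (ψ : DirichletCharacter ℂ r),
      H (DirichletCharacter.changeLevel h ψ) = T r ψ) :
    ∑ χ ∈ nonInducedChars Ξ q, H χ ≤
      ∑ r ∈ q.divisors, ∑ ψ ∈ primitiveCharsOutside Ξ r, T r ψ := by
  classical
  rw [sum_sigma' q.divisors (primitiveCharsOutside Ξ) T]
  have h1 : ∀ χ ∈ nonInducedChars Ξ q, H χ =
      (fun p : Σ r : ℕ, DirichletCharacter ℂ r => T p.1 p.2)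
        ⟨χ.conductor, χ.primitiveCharacter⟩ := by
    intro χ _
    change H χ = T χ.conductor χ.primitiveCharacter
    rw [← hHT χ.conductor χ.conductor_dvd_level, χ.changeLevel_primitiveCharacter]
  -- A character is recovered by inducing its primitive character back to level q.
  have hinj : Function.Injective (fun χ : DirichletCharacter ℂ q =>
      (⟨χ.conductor, χ.primitiveCharacter⟩ : Σ r : ℕ, DirichletCharacter ℂ r)) := by
    refine Function.LeftInverse.injective (g := fun p : Σ r : ℕ, DirichletCharacter ℂ r =>
      if h : p.1 ∣ q then DirichletCharacter.changeLevel h p.2 else 1) fun χ => ?_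
    simp only [dif_pos χ.conductor_dvd_level, χ.changeLevel_primitiveCharacter]
  rw [sum_congr rfl h1, ← sum_image (f := fun p : Σ r : ℕ, DirichletCharacter ℂ r => T p.1 p.2)
    hinj.injOn]
  refine sum_le_sum_of_subset_of_nonneg ?_ fun p _ _ => hT _ _
  intro p hp
  obtain ⟨χ, hχ, rfl⟩ := mem_image.1 hp
  simp only [mem_sigma, Nat.mem_divisors, primitiveCharsOutside, mem_filter, mem_primitiveChars]
  refine ⟨⟨χ.conductor_dvd_level, NeZero.ne q⟩, χ.primitiveCharacter_isPrimitive, fun hm => ?_⟩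
  simp only [nonInducedChars, mem_filter, mem_univ, true_and] at hχ
  exact hχ ⟨_, hm, χ.conductor_dvd_level, χ.changeLevel_primitiveCharacter.symm⟩

/-! ### Reducing f * g to bilinear sums over primitive characters -/

theorem sum_Icc_mul_apply (f g : ArithmeticFunction ℂ) (k : ℕ → ℂ) (X : ℕ) :
    ∑ n ∈ Icc 1 X, (f * g) n * k n =
      ∑ m ∈ Icc 1 X, ∑ n ∈ Icc 1 (X / m), f m * g n * k (m * n) := by
  rw [← sum_Icc_sum_divisors (fun m n => f m * g n * k (m * n))]
  refine sum_congr rfl fun s _ => ?_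
  rw [ArithmeticFunction.mul_apply, sum_mul,
    Nat.sum_divisorsAntidiagonal (fun m n => f m * g n * k s)]
  refine sum_congr rfl fun d hd => ?_
  rw [Nat.mul_div_cancel' (Nat.dvd_of_mem_divisors hd)]

theorem sum_Icc_div_comm {E : Type*} [AddCommMonoid E] (c : ℕ → ℕ → E) (X : ℕ) :
    ∑ m ∈ Icc 1 X, ∑ n ∈ Icc 1 (X / m), c m n = ∑ n ∈ Icc 1 X, ∑ m ∈ Icc 1 (X / n), c m n := by
  rw [sum_sigma', sum_sigma']
  refine sum_bij' (fun p _ => ⟨p.2, p.1⟩) (fun p _ => ⟨p.2, p.1⟩) ?_ ?_ ?_ ?_ ?_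
  all_goals rintro ⟨m, n⟩ h
  · simp only [mem_sigma, mem_Icc] at h ⊢
    have h4 : n * m ≤ X := (Nat.le_div_iff_mul_le (by omega)).1 h.2.2
    exact ⟨⟨h.2.1, h.2.2.trans (Nat.div_le_self _ _)⟩, h.1.1,
      (Nat.le_div_iff_mul_le (by omega)).2 (by linarith)⟩
  · simp only [mem_sigma, mem_Icc] at h ⊢
    have h4 : n * m ≤ X := (Nat.le_div_iff_mul_le (by omega)).1 h.2.2
    exact ⟨⟨h.2.1, h.2.2.trans (Nat.div_le_self _ _)⟩, h.1.1,
      (Nat.le_div_iff_mul_le (by omega)).2 (by linarith)⟩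
  · rfl
  · rfl
  · rfl

theorem sum_Icc_ite_le {E : Type*} [AddCommMonoid E] (F : ℕ → E) {M X : ℕ} (h : M ≤ X) :
    (∑ m ∈ Icc 1 X, if m ≤ M then F m else 0) = ∑ m ∈ Icc 1 M, F m := by
  rw [← sum_filter]
  refine sum_congr ?_ fun _ _ => rfl
  ext m
  simp only [mem_filter, mem_Icc]
  omega

/-- Isolating the terms of a sum over `m n ≤ X` for which one of the variables is small. -/
theorem norm_sum_le_of_split {X M : ℕ} (hM : M * M ≤ X) {c : ℕ → ℕ → ℂ}
    (hc : ∀ m n, ‖c m n‖ ≤ 1) :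
    ‖∑ m ∈ Icc 1 X, ∑ n ∈ Icc 1 (X / m), c m n‖ ≤
      ∑ m ∈ Icc 1 M, ‖∑ n ∈ Icc 1 (X / m), c m n‖ +
      ∑ n ∈ Icc 1 M, ‖∑ m ∈ Icc 1 (X / n), c m n‖ + M ^ 2 +
      ‖∑ m ∈ Icc 1 X, ∑ n ∈ Icc 1 (X / m), if M < m ∧ M < n then c m n else 0‖ := by
  have hMX : M ≤ X := (Nat.le_mul_self M).trans hM
  -- Inclusion–exclusion on the conditions m ≤ M and n ≤ M.
  have h : ∑ m ∈ Icc 1 X, ∑ n ∈ Icc 1 (X / m), c m n =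
      (∑ m ∈ Icc 1 X, if m ≤ M then ∑ n ∈ Icc 1 (X / m), c m n else 0) +
      (∑ m ∈ Icc 1 X, ∑ n ∈ Icc 1 (X / m), if n ≤ M then c m n else 0) -
      (∑ m ∈ Icc 1 X, if m ≤ M then ∑ n ∈ Icc 1 (X / m), if n ≤ M then c m n else 0 else 0) +
      ∑ m ∈ Icc 1 X, ∑ n ∈ Icc 1 (X / m), if M < m ∧ M < n then c m n else 0 := by
    simp only [← sum_add_distrib, ← sum_sub_distrib]
    refine sum_congr rfl fun m _ => ?_
    by_cases hm : m ≤ M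
    · simp [hm, not_lt.2 hm]
    · simp only [hm, if_false, zero_add, sub_zero, ← sum_add_distrib]
      refine sum_congr rfl fun n _ => ?_
      by_cases hn : n ≤ M
      · simp [hn, not_lt.2 hn]
      · simp [hn, not_le.1 hn, not_le.1 hm]
  rw [h, sum_Icc_div_comm (fun m n => if n ≤ M then c m n else 0)]
  have h2 : ∀ n, (∑ m ∈ Icc 1 (X / n), if n ≤ M then c m n else 0) =
      if n ≤ M then ∑ m ∈ Icc 1 (X / n), c m n else 0 := fun n => by
    split_ifs <;> simp
  simp only [h2]
  rw [sum_Icc_ite_le _ hMX, sum_Icc_ite_le _ hMX, sum_Icc_ite_le _ hMX]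
  refine (norm_add_le _ _).trans (add_le_add ((norm_sub_le _ _).trans (add_le_add
    ((norm_add_le _ _).trans (add_le_add (norm_sum_le _ _) (norm_sum_le _ _))) ?_)) le_rfl)
  refine (norm_sum_le _ _).trans ?_
  calc _ ≤ ∑ m ∈ Icc 1 M, (M : ℝ) := by
        refine sum_le_sum fun m hm => ?_
        rw [mem_Icc] at hm
        have : M ≤ X / m := (Nat.le_div_iff_mul_le (by omega)).2
          ((Nat.mul_le_mul_left _ hm.2).trans hM)
        rw [sum_Icc_ite_le _ this]
        refine (norm_sum_le _ _).trans ((sum_le_sum fun n _ => hc m n).trans ?_)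
        simp
    _ = _ := by simp [pow_two]

/-- `max_a |Δ_Ξ(h, X; q, a)|`. -/
noncomputable def maxDelta (Ξ : Set (Σ r : ℕ, DirichletCharacter ℂ r)) (h : ArithmeticFunction ℂ)
    (X : ℝ) (q : ℕ) : ℝ :=
  ⨆ a : (ZMod q)ˣ, ‖DeltaXi Ξ h X q (a : ZMod q)‖

theorem norm_DeltaXi_le_maxDelta {q : ℕ} [NeZero q] (h : ArithmeticFunction ℂ) (X : ℝ)
    (a : (ZMod q)ˣ) : ‖DeltaXi Ξ h X q a‖ ≤ maxDelta Ξ h X q :=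
  le_ciSup (f := fun a : (ZMod q)ˣ => ‖DeltaXi Ξ h X q (a : ZMod q)‖)
    (Set.finite_range _).bddAbove a

theorem maxDelta_nonneg (h : ArithmeticFunction ℂ) (X : ℝ) (q : ℕ) : 0 ≤ maxDelta Ξ h X q :=
  Real.iSup_nonneg fun _ => norm_nonneg _

theorem norm_sum_mul_deltaKernel_le {q : ℕ} [NeZero q] {h : ArithmeticFunction ℂ} {c : ℂ}
    (hc : ‖c‖ ≤ 1) (x : ℝ) (a : (ZMod q)ˣ) (m : ℕ) :
    ‖∑ n ∈ Icc 1 (⌊x⌋₊ / m), c * h n * deltaKernel Ξ q a ((m : ZMod q) * (n : ZMod q))‖ ≤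
      maxDelta Ξ h (x / m) q := by
  by_cases hm : IsUnit (m : ZMod q)
  · obtain ⟨u, hu⟩ := hm
    have := DeltaXi_eq_sum_deltaKernel (Ξ := Ξ) h (x / m) (a * u⁻¹)
    rw [Nat.floor_div_natCast] at this
    simp only [← hu, deltaKernel_unit_mul, mul_assoc, ← mul_sum]
    rw [← this, norm_mul]
    exact (mul_le_of_le_one_left (norm_nonneg _) hc).trans (norm_DeltaXi_le_maxDelta h _ _)
  · simp only [deltaKernel_mul_of_not_isUnit _ hm, mul_zero, sum_const_zero, norm_zero]
    exact maxDelta_nonneg _ _ _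

/-- The restriction of `conj f` to the integers exceeding `M`. -/
noncomputable def truncConj (f : ArithmeticFunction ℂ) (M n : ℕ) : ℂ :=
  if M < n then (starRingEnd ℂ) (f n) else 0

/-- For one small variable the kernel is shifted back to a Δ_Ξ of the other function, or vanishes if
the small variable is not a unit. When both are large the kernel is expanded into characters;
conjugating the coefficients turns conj χ into χ. -/
theorem maxDelta_mul_le {f g : ArithmeticFunction ℂ} (hf : ∀ n, ‖f n‖ ≤ 1) (hg : ∀ n, ‖g n‖ ≤ 1)
    {x : ℝ} {M : ℕ} (hM : M * M ≤ ⌊x⌋₊) {q : ℕ} [NeZero q] :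
    maxDelta Ξ (f * g) x q ≤
      ∑ m ∈ Icc 1 M, maxDelta Ξ g (x / m) q + ∑ m ∈ Icc 1 M, maxDelta Ξ f (x / m) q + M ^ 2 +
      1 / (Nat.totient q : ℝ) * ∑ χ ∈ nonInducedChars Ξ q,
        ‖bilinearCharSum (truncConj f M) (truncConj g M) ⌊x⌋₊ χ‖ := by
  refine ciSup_le fun a => ?_
  rw [DeltaXi_eq_sum_deltaKernel, sum_Icc_mul_apply f g (fun n => deltaKernel Ξ q a (n : ZMod q))]
  have hc : ∀ m n : ℕ, ‖f m * g n * deltaKernel Ξ q a ((m * n : ℕ) : ZMod q)‖ ≤ 1 := by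
    intro m n
    rw [norm_mul, norm_mul]
    exact mul_le_one₀ (mul_le_one₀ (hf m) (norm_nonneg _) (hg n)) (norm_nonneg _)
      (norm_deltaKernel_le _ _)
  refine (norm_sum_le_of_split hM hc).trans ?_
  gcongr ?_ + ?_ + _ + ?_
  · refine sum_le_sum fun m _ => ?_
    have := norm_sum_mul_deltaKernel_le (Ξ := Ξ) (h := g) (hf m) x a m
    simpa only [Nat.cast_mul] using this
  · refine sum_le_sum fun n _ => ?_
    have := norm_sum_mul_deltaKernel_le (Ξ := Ξ) (h := f) (hg n) x a n
    refine le_trans (le_of_eq ?_) this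
    congr 1
    refine sum_congr rfl fun m _ => ?_
    rw [Nat.cast_mul, mul_comm (m : ZMod q), mul_comm (f m)]
  · have e : ∑ m ∈ Icc 1 ⌊x⌋₊, ∑ n ∈ Icc 1 (⌊x⌋₊ / m),
        (if M < m ∧ M < n then f m * g n * deltaKernel Ξ q a ((m * n : ℕ) : ZMod q) else 0) =
        1 / (Nat.totient q : ℂ) * ∑ χ ∈ nonInducedChars Ξ q, χ a *
          (starRingEnd ℂ) (bilinearCharSum (truncConj f M) (truncConj g M) ⌊x⌋₊ χ) := by
      simp only [bilinearCharSum, map_sum, mul_sum]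
      rw [sum_comm]
      refine sum_congr rfl fun m _ => ?_
      rw [sum_comm]
      refine sum_congr rfl fun n _ => ?_
      simp only [truncConj, deltaKernel]
      by_cases h1 : M < m <;> by_cases h2 : M < n <;> simp only [h1, h2, and_self, and_true,
        and_false, if_true, if_false, zero_mul, mul_zero, map_zero, sum_const_zero, map_mul,
        Complex.conj_conj]
      rw [mul_sum, mul_sum]
      refine sum_congr rfl fun χ _ => ?_
      rw [Nat.cast_mul, map_mul, map_mul]
      ring
    rw [e, norm_mul, norm_div, norm_one, Complex.norm_natCast]
    gcongr
    refine (norm_sum_le _ _).trans (sum_le_sum fun χ _ => ?_)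
    rw [norm_mul, RCLike.norm_conj]
    exact mul_le_of_le_one_left (norm_nonneg _) (χ.norm_le_one _)

/-- `∑_{m n ≤ X} conj(f(m) g(n)) ψ(m n)` over the `m`, `n` exceeding `M` and coprime to `s`. -/
noncomputable def twistedSum (f g : ArithmeticFunction ℂ) (M X s : ℕ) {r : ℕ}
    (ψ : DirichletCharacter ℂ r) : ℂ :=
  ∑ m ∈ Icc 1 X, ∑ n ∈ Icc 1 (X / m),
    truncCoprime (fun n => (starRingEnd ℂ) (f n) * ψ (n : ZMod r)) M s m *
      truncCoprime (fun n => (starRingEnd ℂ) (g n) * ψ (n : ZMod r)) M s n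

theorem bilinearCharSum_changeLevel (f g : ArithmeticFunction ℂ) (M X : ℕ) {r s q : ℕ} [NeZero q]
    (hq : q = r * s) (hr : r ∣ q) (ψ : DirichletCharacter ℂ r) :
    bilinearCharSum (truncConj f M) (truncConj g M) X (DirichletCharacter.changeLevel hr ψ) =
      twistedSum f g M X s ψ := by
  subst hq
  have h : ∀ (h : ArithmeticFunction ℂ) (n : ℕ), truncConj h M n *
      DirichletCharacter.changeLevel hr ψ (n : ZMod (r * s)) =
      truncCoprime (fun n => (starRingEnd ℂ) (h n) * ψ (n : ZMod r)) M s n := by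
    intro h n
    rw [changeLevel_mul_natCast s ψ n, truncConj, truncCoprime]
    by_cases h1 : M < n <;> by_cases h2 : n.Coprime s <;> simp [h1, h2]
  simp only [bilinearCharSum, twistedSum, h]

/-- The large sieve needs coefficients independent of ψ, whereas the hyperbola method treats
conj(f)ψ and conj(g)ψ as single functions; the same sum serves both. -/
theorem twistedSum_eq_bilinearCharSum (f g : ArithmeticFunction ℂ) (M X s : ℕ) {r : ℕ}
    (ψ : DirichletCharacter ℂ r) : twistedSum f g M X s ψ =
      bilinearCharSum (truncCoprime (fun n => (starRingEnd ℂ) (f n)) M s)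
        (truncCoprime (fun n => (starRingEnd ℂ) (g n)) M s) X ψ := by
  have h : ∀ (h : ArithmeticFunction ℂ) (n : ℕ),
      truncCoprime (fun n => (starRingEnd ℂ) (h n) * ψ (n : ZMod r)) M s n =
      truncCoprime (fun n => (starRingEnd ℂ) (h n)) M s n * ψ (n : ZMod r) := by
    intro h n
    simp only [truncCoprime, ite_mul, zero_mul]
  simp only [bilinearCharSum, twistedSum, h]

theorem sum_nonInducedChars_bilinearCharSum_le (f g : ArithmeticFunction ℂ) (M X Q : ℕ) :
    ∑ q ∈ Icc 1 Q, 1 / (Nat.totient q : ℝ) * ∑ χ ∈ nonInducedChars Ξ q,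
        ‖bilinearCharSum (truncConj f M) (truncConj g M) X χ‖ ≤
      ∑ r ∈ Icc 1 Q, 1 / (Nat.totient r : ℝ) * ∑ ψ ∈ primitiveCharsOutside Ξ r,
        ∑ s ∈ Icc 1 Q, 1 / (Nat.totient s : ℝ) * ‖twistedSum f g M X s ψ‖ := by
  set G : ℕ → ℕ → ℝ := fun r s => 1 / (Nat.totient r : ℝ) * (1 / (Nat.totient s : ℝ)) *
    ∑ ψ ∈ primitiveCharsOutside Ξ r, ‖twistedSum f g M X s ψ‖ with hG
  have hG0 : ∀ r s, 0 ≤ G r s := fun r s => by positivity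
  have h1 : ∀ q ∈ Icc 1 Q, 1 / (Nat.totient q : ℝ) * ∑ χ ∈ nonInducedChars Ξ q,
        ‖bilinearCharSum (truncConj f M) (truncConj g M) X χ‖ ≤
      ∑ r ∈ q.divisors, G r (q / r) := by
    intro q hq
    have hq0 : 0 < q := (mem_Icc.1 hq).1
    have : NeZero q := ⟨hq0.ne'⟩
    have h2 := sum_nonInducedChars_le (Ξ := Ξ) (q := q)
      (H := fun χ => ‖bilinearCharSum (truncConj f M) (truncConj g M) X χ‖)
      (T := fun r ψ => ‖twistedSum f g M X (q / r) ψ‖) (fun _ _ => norm_nonneg _)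
      (fun r h ψ => by rw [bilinearCharSum_changeLevel f g M X (Nat.mul_div_cancel' h).symm h ψ])
    refine (mul_le_mul_of_nonneg_left h2 (by positivity)).trans ?_
    rw [mul_sum]
    refine sum_le_sum fun r hr => ?_
    have hr1 := Nat.dvd_of_mem_divisors hr
    have hr0 : 0 < r := Nat.pos_of_dvd_of_pos hr1 hq0
    have hs0 : 0 < q / r := Nat.div_pos (Nat.le_of_dvd hq0 hr1) hr0
    have h3 : (0 : ℝ) < Nat.totient r := by exact_mod_cast Nat.totient_pos.2 hr0
    have h4 : (0 : ℝ) < Nat.totient (q / r) := by exact_mod_cast Nat.totient_pos.2 hs0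
    have h5 : (Nat.totient r : ℝ) * Nat.totient (q / r) ≤ Nat.totient q := by
      have := Nat.totient_super_multiplicative r (q / r)
      rw [Nat.mul_div_cancel' hr1] at this
      exact_mod_cast this
    simp only [hG]
    gcongr
    rw [div_mul_div_comm, one_mul]
    gcongr
  refine (sum_le_sum h1).trans ?_
  rw [sum_Icc_sum_divisors G]
  refine sum_le_sum fun r _ => ?_
  refine (sum_le_sum_of_subset_of_nonneg (Icc_subset_Icc_right (Nat.div_le_self Q r))
    fun s _ _ => hG0 r s).trans (le_of_eq ?_)
  simp only [hG, mul_sum]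
  rw [sum_comm]
  exact sum_congr rfl fun ψ _ => sum_congr rfl fun s _ => by ring

theorem norm_conj_mul_apply_le {f : ArithmeticFunction ℂ} (hf : ∀ n, ‖f n‖ ≤ 1) {r : ℕ}
    (ψ : DirichletCharacter ℂ r) (n : ℕ) : ‖(starRingEnd ℂ) (f n) * ψ (n : ZMod r)‖ ≤ 1 := by
  rw [norm_mul, RCLike.norm_conj]
  exact mul_le_one₀ (hf n) (norm_nonneg _) (ψ.norm_le_one _)

/-- Up to conjugation this is the character sum of the character mod rk induced by ψ, which is again
outside Ξ. Inverting Δ_Ξ costs φ(rk) ≤ r φ(k). -/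
theorem norm_coprimeSum_le (hΞ : IsPrimitiveCharSet Ξ) {h : ArithmeticFunction ℂ} {y δ : ℝ}
    (hδ0 : 0 ≤ δ)
    (hδ : ∀ q : ℕ, 1 ≤ q → ∀ a : (ZMod q)ˣ, ‖DeltaXi Ξ h y q (a : ZMod q)‖ ≤ δ) {r : ℕ}
    (hr : 0 < r) {ψ : DirichletCharacter ℂ r} (hψ : ψ ∈ primitiveCharsOutside Ξ r) {k : ℕ}
    (hk : 1 ≤ k) :
    ‖coprimeSum (fun n => (starRingEnd ℂ) (h n) * ψ (n : ZMod r)) ⌊y⌋₊ k‖ ≤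
      r * Nat.totient k * δ := by
  have hrk : 0 < r * k := Nat.mul_pos hr hk
  have : NeZero (r * k) := ⟨hrk.ne'⟩
  have h1 := norm_charSum_le (changeLevel_mem_nonInducedChars hΞ (Dvd.intro k rfl : r ∣ r * k) hψ)
    (hδ (r * k) hrk)
  have h2 : ‖coprimeSum (fun n => (starRingEnd ℂ) (h n) * ψ (n : ZMod r)) ⌊y⌋₊ k‖ =
      ‖charSum h y (DirichletCharacter.changeLevel (Dvd.intro k rfl : r ∣ r * k) ψ)‖ := by
    rw [← RCLike.norm_conj, coprimeSum, charSum, map_sum]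
    congr 1
    refine sum_congr rfl fun n _ => ?_
    rw [changeLevel_mul_natCast k ψ n]
    split_ifs <;> simp
  rw [h2]
  refine h1.trans ?_
  gcongr
  exact_mod_cast totient_mul_le r k

/-! ### Assembling small and large conductors -/

/-- The explicit form of the bound for the bilinear sums. -/
theorem sum_nonInducedChars_bilinearCharSum_le_explicit (hΞ : IsPrimitiveCharSet Ξ)
    {f g : ArithmeticFunction ℂ} (hf : ∀ n, ‖f n‖ ≤ 1) (hg : ∀ n, ‖g n‖ ≤ 1)
    {x η Φ : ℝ} {M Q R z J : ℕ} (hx : 1 ≤ x) (hη : 0 ≤ η) (hM : 0 < M) (hR : 0 < R) (hz : 0 < z)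
    (hQ : Q ≤ ⌊x⌋₊) (hJ : ⌊x⌋₊ + 1 < 2 ^ J)
    (hΦ : ∑ s ∈ Icc 1 Q, 1 / (Nat.totient s : ℝ) ≤ Φ)
    (hfη : ∀ y, Real.sqrt x ≤ y → y ≤ x → ∀ q : ℕ, 1 ≤ q → ∀ a : (ZMod q)ˣ,
      ‖DeltaXi Ξ f y q (a : ZMod q)‖ ≤ η * y)
    (hgη : ∀ y, Real.sqrt x ≤ y → y ≤ x → ∀ q : ℕ, 1 ≤ q → ∀ a : (ZMod q)ˣ,
      ‖DeltaXi Ξ g y q (a : ZMod q)‖ ≤ η * y) :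
    ∑ q ∈ Icc 1 Q, 1 / (Nat.totient q : ℝ) * ∑ χ ∈ nonInducedChars Ξ q,
        ‖bilinearCharSum (truncConj f M) (truncConj g M) ⌊x⌋₊ χ‖ ≤
      R * (Φ * (R * η * z ^ 2 + Φ / z) * (x * (3 + 2 * Real.log x)) +
        3 * M * Real.sqrt x * Φ) +
      Φ * (J ^ 2 * (J * (72 * (x / R) + 144 * (x / Real.sqrt M)) + 144 * Q * Real.sqrt x)) := by
  have hx0 : 0 ≤ x := by linarith
  have hΦ0 : 0 ≤ Φ := le_trans (by positivity) hΦ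
  have hz' : (0 : ℝ) < z := by exact_mod_cast hz
  have hlog : 0 ≤ Real.log x := Real.log_nonneg hx
  set X := ⌊x⌋₊ with hX
  have hXx : (X : ℝ) ≤ x := Nat.floor_le hx0
  refine (sum_nonInducedChars_bilinearCharSum_le f g M X Q).trans ?_
  set F : ℕ → ℝ := fun r => 1 / (Nat.totient r : ℝ) * ∑ ψ ∈ primitiveCharsOutside Ξ r,
        ∑ s ∈ Icc 1 Q, 1 / (Nat.totient s : ℝ) * ‖twistedSum f g M X s ψ‖ with hF
  have hF0 : ∀ r, 0 ≤ F r := fun r => by positivity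
  have hsplit : ∑ r ∈ Icc 1 Q, F r ≤ ∑ r ∈ Icc 1 R, F r + ∑ r ∈ Ioc R Q, F r := by
    rw [← sum_union]
    · refine sum_le_sum_of_subset_of_nonneg (fun r hr => ?_) fun r _ _ => hF0 r
      simp only [mem_union, mem_Icc, mem_Ioc] at hr ⊢
      omega
    · rw [disjoint_left]
      intro r
      simp only [mem_Icc, mem_Ioc]
      omega
  refine hsplit.trans (add_le_add ?_ ?_)
  · set bd := Φ * (R * η * z ^ 2 + Φ / z) * (x * (3 + 2 * Real.log x)) +
        3 * M * Real.sqrt x * Φ with hbd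
    have hbd0 : 0 ≤ bd := by positivity
    have h1 : ∀ r ∈ Icc 1 R, F r ≤ bd := by
      intro r hr
      rw [mem_Icc] at hr
      have : NeZero r := ⟨by omega⟩
      have hφ : (0 : ℝ) < Nat.totient r := by exact_mod_cast Nat.totient_pos.2 hr.1
      have hrR : (r : ℝ) ≤ R := by exact_mod_cast hr.2
      have h2 : ∀ ψ ∈ primitiveCharsOutside Ξ r,
          ∑ s ∈ Icc 1 Q, 1 / (Nat.totient s : ℝ) * ‖twistedSum f g M X s ψ‖ ≤ bd := by
        intro ψ hψ
        -- The loss r ≤ R is put into ε = Rη, leaving only the factor φ(k).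
        have key : ∀ h : ArithmeticFunction ℂ, (∀ y, Real.sqrt x ≤ y → y ≤ x → ∀ q : ℕ, 1 ≤ q →
            ∀ a : (ZMod q)ˣ, ‖DeltaXi Ξ h y q (a : ZMod q)‖ ≤ η * y) →
            ∀ y, Real.sqrt x ≤ y → y ≤ x → ∀ k, 1 ≤ k →
            ‖coprimeSum (fun n => (starRingEnd ℂ) (h n) * ψ (n : ZMod r)) ⌊y⌋₊ k‖ ≤
              (R * η) * Nat.totient k * y := by
          intro h hh y hy hy' k hk
          have hy0 : 0 ≤ y := (Real.sqrt_nonneg x).trans hy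
          refine (norm_coprimeSum_le hΞ (by positivity) (hh y hy hy') hr.1 hψ hk).trans ?_
          calc (r : ℝ) * Nat.totient k * (η * y) ≤ R * Nat.totient k * (η * y) := by gcongr
            _ = _ := by ring
        exact sum_norm_sum_truncCoprime_le (norm_conj_mul_apply_le hf ψ)
          (norm_conj_mul_apply_le hg ψ) (M := M) hx hz (by positivity) hΦ (key f hfη) (key g hgη)
      simp only [hF]
      calc _ ≤ 1 / (Nat.totient r : ℝ) * ∑ ψ ∈ primitiveCharsOutside Ξ r, bd := by
            gcongr with ψ hψ
            exact h2 ψ hψ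
        -- There are at most φ(r) characters mod r, which the weight cancels; summing over r ≤ R
        -- then costs R.
        _ ≤ 1 / (Nat.totient r : ℝ) * (Nat.totient r * bd) := by
            rw [sum_const, nsmul_eq_mul]
            gcongr
            exact_mod_cast card_le_totient _
        _ = bd := by field_simp
    refine (sum_le_sum h1).trans ?_
    simp
  · have h1 : ∑ r ∈ Ioc R Q, F r ≤ ∑ s ∈ Icc 1 Q, 1 / (Nat.totient s : ℝ) *
        ∑ r ∈ Ioc R Q, 1 / (Nat.totient r : ℝ) *
          ∑ ψ ∈ primitiveChars r, ‖twistedSum f g M X s ψ‖ := by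
      have h2 : ∀ r, F r ≤ ∑ s ∈ Icc 1 Q, 1 / (Nat.totient s : ℝ) *
          (1 / (Nat.totient r : ℝ) * ∑ ψ ∈ primitiveChars r, ‖twistedSum f g M X s ψ‖) := by
        intro r
        calc F r ≤ 1 / (Nat.totient r : ℝ) * ∑ ψ ∈ primitiveChars r,
              ∑ s ∈ Icc 1 Q, 1 / (Nat.totient s : ℝ) * ‖twistedSum f g M X s ψ‖ := by
              refine mul_le_mul_of_nonneg_left ?_ (by positivity)
              exact sum_le_sum_of_subset_of_nonneg (primitiveCharsOutside_subset Ξ r)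
                fun _ _ _ => by positivity
          _ = _ := by
              rw [sum_comm, mul_sum]
              refine sum_congr rfl fun s _ => ?_
              rw [← mul_sum]
              ring
      refine (sum_le_sum fun r _ => h2 r).trans (le_of_eq ?_)
      rw [sum_comm]
      exact sum_congr rfl fun s _ => (mul_sum _ _ _).symm
    refine h1.trans ?_
    calc _ ≤ ∑ s ∈ Icc 1 Q, 1 / (Nat.totient s : ℝ) *
          (J ^ 2 * (J * (72 * (x / R) + 144 * (x / Real.sqrt M)) + 144 * Q * Real.sqrt x)) := by
          refine sum_le_sum fun s _ => ?_
          gcongr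
          simp only [twistedSum_eq_bilinearCharSum]
          have hb : ∀ (h : ArithmeticFunction ℂ), (∀ n, ‖h n‖ ≤ 1) →
              ∀ n, ‖(starRingEnd ℂ) (h n)‖ ≤ 1 := fun h hh n => by
            rw [RCLike.norm_conj]; exact hh n
          have h0 : ∀ (h : ℕ → ℂ), ∀ n ≤ M, truncCoprime h M s n = 0 := fun h n hn => by
            rw [truncCoprime, if_neg]; omega
          refine (sum_norm_bilinearCharSum_le hM hR hJ hQ (norm_truncCoprime_le (hb f hf) M s)
            (norm_truncCoprime_le (hb g hg) M s) (h0 _) (h0 _)).trans ?_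
          gcongr
      _ ≤ _ := by
          rw [← sum_mul]
          gcongr

theorem sumMaxDelta_mul_le {f g : ArithmeticFunction ℂ} (hf : ∀ n, ‖f n‖ ≤ 1)
    (hg : ∀ n, ‖g n‖ ≤ 1) {x Q : ℝ} {M : ℕ} (hM : M * M ≤ ⌊x⌋₊) :
    sumMaxDelta Ξ (f * g) x Q ≤
      ∑ m ∈ Icc 1 M, sumMaxDelta Ξ g (x / m) Q + ∑ m ∈ Icc 1 M, sumMaxDelta Ξ f (x / m) Q +
      M ^ 2 * ⌊Q⌋₊ +
      ∑ q ∈ Icc 1 ⌊Q⌋₊, 1 / (Nat.totient q : ℝ) * ∑ χ ∈ nonInducedChars Ξ q,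
        ‖bilinearCharSum (truncConj f M) (truncConj g M) ⌊x⌋₊ χ‖ := by
  calc sumMaxDelta Ξ (f * g) x Q = ∑ q ∈ Icc 1 ⌊Q⌋₊, maxDelta Ξ (f * g) x q := rfl
    _ ≤ ∑ q ∈ Icc 1 ⌊Q⌋₊, (∑ m ∈ Icc 1 M, maxDelta Ξ g (x / m) q +
        ∑ m ∈ Icc 1 M, maxDelta Ξ f (x / m) q + M ^ 2 +
        1 / (Nat.totient q : ℝ) * ∑ χ ∈ nonInducedChars Ξ q,
          ‖bilinearCharSum (truncConj f M) (truncConj g M) ⌊x⌋₊ χ‖) := by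
        refine sum_le_sum fun q hq => ?_
        have : NeZero q := ⟨by have := (mem_Icc.1 hq).1; omega⟩
        exact maxDelta_mul_le hf hg hM
    _ = _ := by
        rw [sum_add_distrib, sum_add_distrib, sum_add_distrib, sum_comm,
          sum_comm (f := fun q m => maxDelta Ξ f (x / (m : ℕ)) q), sum_const, nsmul_eq_mul,
          Nat.card_Icc, Nat.add_sub_cancel, mul_comm (⌊Q⌋₊ : ℝ)]
        rfl

/-! ### Choice of parameters and conclusion -/

/-- The small values of one of the variables contribute `O(x / u)`, where `u = (log x) ^ D`. -/
theorem sum_sumMaxDelta_div_le {h : ArithmeticFunction ℂ} {x Q K u V l c : ℝ} {M : ℕ}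
    (hx : 0 < x) (hu : 0 < u) (hl : 1 ≤ l) (hMV : M ≤ V)
    (hlog : Real.log M ≤ c * l) (hK : 0 ≤ K)
    (hyp : ∀ X : ℝ, x / V ≤ X → X ≤ x → sumMaxDelta Ξ h X Q ≤ K * (X / (u * l))) :
    ∑ m ∈ Icc 1 M, sumMaxDelta Ξ h (x / m) Q ≤ K * (1 + c) * (x / u) := by
  calc _ ≤ ∑ m ∈ Icc 1 M, K * (x / (u * l)) * (1 / (m : ℝ)) := by
        refine sum_le_sum fun m hm => ?_
        rw [mem_Icc] at hm
        have hm1 : (1 : ℝ) ≤ m := by exact_mod_cast hm.1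
        have hmM : (m : ℝ) ≤ M := by exact_mod_cast hm.2
        refine (hyp (x / m) ?_ (div_le_self hx.le hm1)).trans (le_of_eq ?_)
        · gcongr
          exact hmM.trans hMV
        · field_simp
    -- Here 1 + log M ≤ l(1 + c) because l ≥ 1, and this l cancels the one saved in the hypothesis.
    _ ≤ K * (x / (u * l)) * (l * (1 + c)) := by
        rw [← mul_sum]
        gcongr
        exact (sum_Icc_inv_le M).trans (by linarith)
    _ = _ := by field_simp

/-- The numerical bookkeeping: `L = log x`, `u = (log x) ^ D`, `ρ = √x`. -/
theorem bilinear_bound_le {x ρ L u K Q M sM R z J Φ : ℝ} (hρ : 0 ≤ ρ) (hx : ρ * ρ = x)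
    (hL : 1 ≤ L) (hu : 1 ≤ u) (hK : 0 ≤ K) (hbig : u ^ 9 * L ^ 16 ≤ ρ) (hQ0 : 0 ≤ Q)
    (hQ : Q ≤ ρ / (u ^ 2 * L ^ 3)) (hM : M ≤ u ^ 4 * L ^ 8) (hM0 : 0 ≤ M)
    (hsM : u ^ 2 * L ^ 4 / 2 ≤ sM)
    (hR : u * L ^ 4 ≤ R) (hR' : R ≤ 2 * (u * L ^ 4)) (hz : u ^ 2 * L ^ 7 ≤ z)
    (hz' : z ≤ 2 * (u ^ 2 * L ^ 7)) (hJ0 : 0 ≤ J) (hJ : J ≤ 4 * L) (hΦ0 : 0 ≤ Φ)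
    (hΦ : Φ ≤ 8 * L) :
    R * (Φ * (R * (K / (u ^ 14 * L ^ 28)) * z ^ 2 + Φ / z) * (x * (3 + 2 * L)) +
        3 * M * ρ * Φ) +
      Φ * (J ^ 2 * (J * (72 * (x / R) + 144 * (x / sM)) + 144 * Q * ρ)) +
      M ^ 2 * Q ≤ (640 * K + 300000) * (x / u) := by
  have hu0 : 0 < u := by linarith
  have hL0 : 0 < L := by linarith
  have hx0 : 0 ≤ x := by rw [← hx]; positivity
  have hR0 : 0 < R := lt_of_lt_of_le (by positivity) hR
  have hz0 : 0 < z := lt_of_lt_of_le (by positivity) hz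
  have hsM0 : 0 < sM := lt_of_lt_of_le (by positivity) hsM
  have e1 : R * (K / (u ^ 14 * L ^ 28)) * z ^ 2 ≤ 8 * K / (u ^ 2 * L ^ 6) := by
    calc R * (K / (u ^ 14 * L ^ 28)) * z ^ 2
        ≤ 2 * (u * L ^ 4) * (K / (u ^ 14 * L ^ 28)) * (2 * (u ^ 2 * L ^ 7)) ^ 2 := by gcongr
      _ = 8 * K / (u ^ 9 * L ^ 10) := by field_simp; ring
      _ ≤ 8 * K / (u ^ 2 * L ^ 6) := by
          gcongr <;> first | assumption | norm_num
  have e2 : Φ / z ≤ 8 / (u ^ 2 * L ^ 6) := by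
    calc Φ / z ≤ 8 * L / (u ^ 2 * L ^ 7) := by gcongr
      _ = _ := by field_simp
  -- The size of z is dictated by the tail: RΦ²L/z is of order uL⁷/z, which must be at most of order
  -- 1/u.
  have e3 : R * (Φ * (R * (K / (u ^ 14 * L ^ 28)) * z ^ 2 + Φ / z) * (x * (3 + 2 * L))) ≤
      640 * (K + 1) * (x / u) := by
    calc _ ≤ 2 * (u * L ^ 4) * (8 * L * (8 * K / (u ^ 2 * L ^ 6) + 8 / (u ^ 2 * L ^ 6)) *
          (x * (5 * L))) := by
          gcongr
          linarith
      _ = _ := by field_simp; ring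
  have hbig2 : u ^ 6 * L ^ 13 ≤ ρ := by
    refine le_trans ?_ hbig
    gcongr <;> first | assumption | norm_num
  have e4 : R * (3 * M * ρ * Φ) ≤ 48 * (x / u) := by
    calc _ ≤ 2 * (u * L ^ 4) * (3 * (u ^ 4 * L ^ 8) * ρ * (8 * L)) := by gcongr
      _ = 48 * (u ^ 6 * L ^ 13 * ρ / u) := by field_simp; ring
      _ ≤ 48 * (ρ * ρ / u) := by gcongr
      _ = _ := by rw [hx]
  have hQρ : Q * ρ ≤ x / (u * L ^ 3) := by
    calc Q * ρ ≤ ρ / (u ^ 2 * L ^ 3) * ρ := by gcongr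
      _ = x / (u ^ 2 * L ^ 3) := by rw [← hx]; ring
      _ ≤ x / (u ^ 1 * L ^ 3) := by
          gcongr
          norm_num
      _ = _ := by rw [pow_one]
  have e5 : x / R ≤ x / (u * L ^ 4) := by gcongr
  have e6 : x / sM ≤ 2 * (x / (u * L ^ 4)) := by
    calc x / sM ≤ x / (u ^ 2 * L ^ 4 / 2) := by gcongr
      _ = 2 * (x / (u ^ 2 * L ^ 4)) := by field_simp
      _ ≤ 2 * (x / (u ^ 1 * L ^ 4)) := by
          gcongr
          norm_num
      _ = _ := by rw [pow_one]
  -- ΦJ³ is of order L⁴, absorbed by R and √M; ΦJ² is of order L³, absorbed by the L³ in the bound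
  -- for Q.
  have e7 : Φ * (J ^ 2 * (J * (72 * (x / R) + 144 * (x / sM)) + 144 * Q * ρ)) ≤
      202752 * (x / u) := by
    calc _ ≤ 8 * L * ((4 * L) ^ 2 * (4 * L * (72 * (x / (u * L ^ 4)) +
          144 * (2 * (x / (u * L ^ 4)))) + 144 * (x / (u * L ^ 3)))) := by
          rw [mul_assoc 144 Q ρ]
          gcongr
      _ = _ := by field_simp; ring
  have e8 : M ^ 2 * Q ≤ x / u := by
    have hQρ' : Q ≤ ρ := hQ.trans (div_le_self hρ (by
      have h1 : 1 ≤ u ^ 2 := one_le_pow₀ hu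
      have h2 : 1 ≤ L ^ 3 := one_le_pow₀ hL
      nlinarith))
    calc M ^ 2 * Q ≤ (u ^ 4 * L ^ 8) ^ 2 * ρ := by gcongr
      _ = u ^ 9 * L ^ 16 * ρ / u := by field_simp
      _ ≤ ρ * ρ / u := by gcongr
      _ = _ := by rw [hx]
  have hxu : 0 ≤ x / u := by positivity
  rw [mul_add]
  nlinarith

end

theorem exists_forall_log_rpow_le_sqrt (b : ℝ) :
    ∃ x₀ : ℝ, ∀ x, x₀ ≤ x → 1 ≤ x ∧ Real.exp 1 ≤ Real.log x ∧ Real.log x ^ b ≤ Real.sqrt x := by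
  have h1 := (isLittleO_log_rpow_rpow_atTop b (by norm_num : (0 : ℝ) < 1 / 2)).bound one_pos
  have h2 := Real.tendsto_log_atTop.eventually_ge_atTop (Real.exp 1)
  obtain ⟨x₀, h⟩ := Filter.eventually_atTop.1 ((h1.and h2).and (Filter.eventually_ge_atTop 1))
  refine ⟨x₀, fun x hx => ?_⟩
  obtain ⟨⟨a1, a2⟩, a3⟩ := h x hx
  refine ⟨a3, a2, ?_⟩
  rw [one_mul, ← Real.sqrt_eq_rpow, Real.norm_of_nonneg (Real.sqrt_nonneg x)] at a1
  exact (le_abs_self _).trans a1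

theorem natCeil_le_two_mul {y : ℝ} (hy : 1 ≤ y) : (⌈y⌉₊ : ℝ) ≤ 2 * y := by
  have := Nat.ceil_lt_add_one (by linarith : 0 ≤ y)
  linarith

theorem exists_floor_add_one_lt_two_pow {x : ℝ} (hx : 1 ≤ x) (hL : 1 ≤ Real.log x) :
    ∃ J : ℕ, ⌊x⌋₊ + 1 < 2 ^ J ∧ (J : ℝ) ≤ 4 * Real.log x := by
  refine ⟨Nat.log 2 (⌊x⌋₊ + 1) + 1, Nat.lt_pow_succ_log_self (by norm_num) _, ?_⟩
  have h1 : 2 ^ Nat.log 2 (⌊x⌋₊ + 1) ≤ ⌊x⌋₊ + 1 := Nat.pow_log_le_self 2 (by omega)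
  have h2 : (2 : ℝ) ^ Nat.log 2 (⌊x⌋₊ + 1) ≤ 2 * x := by
    have h3 : (2 : ℝ) ^ Nat.log 2 (⌊x⌋₊ + 1) ≤ ⌊x⌋₊ + 1 := by exact_mod_cast h1
    have := Nat.floor_le (by linarith : 0 ≤ x)
    linarith
  have h4 := Real.log_le_log (by positivity) h2
  rw [Real.log_pow, Real.log_mul (by norm_num) (by linarith)] at h4
  have h5 := Real.log_two_gt_d9
  have h6 := Real.log_two_lt_d9
  push_cast
  nlinarith

/-- All implied constants are uniform: the constant `K'` of the conclusion depends only on `D` and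
on the constant `K` of the hypotheses, and `x₀` only on `D`. -/
theorem proposition3p2 (D : ℝ) (hD : 0 ≤ D) :
    ∃ x₀ : ℝ, ∀ K : ℝ, ∃ K' : ℝ, ∀ x : ℝ, x₀ ≤ x →
      ∀ Ξ : Set (Σ r : ℕ, DirichletCharacter ℂ r), IsPrimitiveCharSet Ξ →
      ∀ f g : ArithmeticFunction ℂ,
      ∀ Q : ℝ, 2 ≤ Q → Q ≤ Real.sqrt x / (Real.log x) ^ (2 * D + 3) →
      (∀ h : ArithmeticFunction ℂ, (h = f ∨ h = g) →
        (∀ n : ℕ, ‖h n‖ ≤ 1) ∧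
        (∀ X : ℝ, Real.sqrt x ≤ X → X ≤ x → ∀ q : ℕ, 1 ≤ q → ∀ a : (ZMod q)ˣ,
          ‖DeltaXi Ξ h X q (a : ZMod q)‖ ≤ K * (X / (Real.log x) ^ (14 * D + 28))) ∧
        (∀ X : ℝ, x / (Real.log x) ^ (4 * D + 8) ≤ X → X ≤ x →
          sumMaxDelta Ξ h X Q ≤
            K * (X / ((Real.log x) ^ D * Real.log (Real.log x))))) →
      sumMaxDelta Ξ (f * g) x Q ≤ K' * (x / (Real.log x) ^ D) := by
  -- The exponent comes from M²Q ≤ u⁸L¹⁶√x, which has to be at most x/u.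
  obtain ⟨x₀, hx₀⟩ := exists_forall_log_rpow_le_sqrt (9 * D + 16)
  -- The first term collects the small values of either variable, with log M ≤ (4D + 8) log log x.
  -- The maximum with 0 allows for a negative constant in the hypotheses.
  refine ⟨x₀, fun K₀ => ⟨2 * (max K₀ 0 * (1 + (4 * D + 8))) + (640 * max K₀ 0 + 300000), ?_⟩⟩
  intro x hx Ξ hΞ f g Q hQ2 hQ hyp
  obtain ⟨hx1, hLe, hbig⟩ := hx₀ x hx
  set K := max K₀ 0 with hK
  have hK0 : 0 ≤ K := le_max_right _ _
  have hKK : K₀ ≤ K := le_max_left _ _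
  set L := Real.log x with hL
  set u := L ^ D with hu
  set l := Real.log L with hl
  have hL1 : 1 ≤ L := le_trans (by linarith [Real.add_one_le_exp 1]) hLe
  have hL0 : 0 < L := by linarith
  have hu1 : 1 ≤ u := Real.one_le_rpow hL1 hD
  have hl1 : 1 ≤ l := by
    rw [hl, Real.le_log_iff_exp_le hL0]; exact hLe
  have hpow : ∀ i j : ℕ, L ^ ((i : ℝ) * D + j) = u ^ i * L ^ j := by
    intro i j
    rw [Real.rpow_add hL0, Real.rpow_natCast, mul_comm (i : ℝ) D, Real.rpow_mul hL0.le,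
      Real.rpow_natCast]
  have p2 : L ^ (2 * D + 3) = u ^ 2 * L ^ 3 := by exact_mod_cast hpow 2 3
  have p14 : L ^ (14 * D + 28) = u ^ 14 * L ^ 28 := by exact_mod_cast hpow 14 28
  have p4 : L ^ (4 * D + 8) = u ^ 4 * L ^ 8 := by exact_mod_cast hpow 4 8
  have p9 : L ^ (9 * D + 16) = u ^ 9 * L ^ 16 := by exact_mod_cast hpow 9 16
  have hlogV : Real.log (u ^ 4 * L ^ 8) = (4 * D + 8) * l := by
    rw [← p4, Real.log_rpow hL0]
  rw [p2] at hQ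
  rw [p9] at hbig
  simp only [p14, p4] at hyp
  have hx0 : 0 < x := by linarith
  set ρ := Real.sqrt x with hρ
  have hρx : ρ * ρ = x := Real.mul_self_sqrt hx0.le
  have hρ1 : 1 ≤ ρ := Real.one_le_sqrt.2 hx1
  have one_le : ∀ i j : ℕ, 1 ≤ u ^ i * L ^ j := fun i j =>
    one_le_mul_of_one_le_of_one_le (one_le_pow₀ hu1) (one_le_pow₀ hL1)
  set V := u ^ 4 * L ^ 8 with hV
  have hV1 : 1 ≤ V := one_le 4 8
  set M := ⌊V⌋₊ with hM
  have hM0 : 0 < M := Nat.floor_pos.2 hV1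
  have hMV : (M : ℝ) ≤ V := Nat.floor_le (by linarith)
  have hM2V : V ≤ 2 * M := by
    have h1 : V < M + 1 := Nat.lt_floor_add_one V
    have h2 : (1 : ℝ) ≤ M := by exact_mod_cast hM0
    linarith
  have hMM : M * M ≤ ⌊x⌋₊ := by
    refine Nat.le_floor ?_
    push_cast
    have h1 : V ≤ ρ := by
      refine le_trans ?_ hbig
      rw [hV]
      gcongr <;> first | assumption | norm_num
    rw [← hρx]
    gcongr <;> linarith
  have hQρ : Q ≤ ρ := hQ.trans (div_le_self (by linarith) (one_le 2 3))
  have hQx : Q ≤ x := by nlinarith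
  have hlogM : Real.log M ≤ (4 * D + 8) * l := by
    rw [← hlogV]
    exact Real.log_le_log (by exact_mod_cast hM0) hMV
  obtain ⟨J, hJ, hJL⟩ := exists_floor_add_one_lt_two_pow hx1 hL1
  obtain ⟨hf1, hf2, hf3⟩ := hyp f (Or.inl rfl)
  obtain ⟨hg1, hg2, hg3⟩ := hyp g (Or.inr rfl)
  have hR1 : 1 ≤ u * L ^ 4 := by simpa using one_le 1 4
  have hz1 : 1 ≤ u ^ 2 * L ^ 7 := one_le 2 7
  have hQ0 : 0 ≤ Q := by linarith
  have hQfl : (⌊Q⌋₊ : ℝ) ≤ Q := Nat.floor_le hQ0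
  have hQ1 : 1 ≤ ⌊Q⌋₊ := Nat.le_floor (by push_cast; linarith)
  have hlogQ : Real.log ⌊Q⌋₊ ≤ L :=
    Real.log_le_log (by exact_mod_cast hQ1) (hQfl.trans hQx)
  have small : ∀ h : ArithmeticFunction ℂ, (∀ X : ℝ, x / V ≤ X → X ≤ x →
      sumMaxDelta Ξ h X Q ≤ K₀ * (X / (u * l))) →
      ∑ m ∈ Icc 1 M, sumMaxDelta Ξ h (x / m) Q ≤ K * (1 + (4 * D + 8)) * (x / u) := by
    intro h hh
    refine sum_sumMaxDelta_div_le hx0 (by linarith) hl1 hMV hlogM hK0 ?_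
    intro X hX hX'
    have : 0 ≤ X := le_trans (by positivity) hX
    refine (hh X hX hX').trans ?_
    gcongr
  have siegel : ∀ h : ArithmeticFunction ℂ, (∀ X : ℝ, ρ ≤ X → X ≤ x → ∀ q : ℕ, 1 ≤ q →
      ∀ a : (ZMod q)ˣ, ‖DeltaXi Ξ h X q (a : ZMod q)‖ ≤ K₀ * (X / (u ^ 14 * L ^ 28))) →
      ∀ X : ℝ, ρ ≤ X → X ≤ x → ∀ q : ℕ, 1 ≤ q → ∀ a : (ZMod q)ˣ,
        ‖DeltaXi Ξ h X q (a : ZMod q)‖ ≤ K / (u ^ 14 * L ^ 28) * X := by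
    intro h hh X hX hX' q hq a
    have : 0 ≤ X := by linarith
    calc _ ≤ K₀ * (X / (u ^ 14 * L ^ 28)) := hh X hX hX' q hq a
      _ ≤ K * (X / (u ^ 14 * L ^ 28)) := by gcongr
      _ = _ := by ring
  have bil := sum_nonInducedChars_bilinearCharSum_le_explicit hΞ hf1 hg1 (M := M) (Q := ⌊Q⌋₊)
    (R := ⌈u * L ^ 4⌉₊) (z := ⌈u ^ 2 * L ^ 7⌉₊) hx1 (by positivity) hM0
    (Nat.ceil_pos.2 (by linarith)) (Nat.ceil_pos.2 (by linarith)) (Nat.floor_le_floor hQx) hJ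
    (sum_inv_totient_le ⌊Q⌋₊) (siegel f hf2) (siegel g hg2)
  have num := bilinear_bound_le (x := x) (ρ := ρ) (L := L) (u := u) (K := K) (Q := ⌊Q⌋₊) (M := M)
    (sM := Real.sqrt M) (R := ⌈u * L ^ 4⌉₊) (z := ⌈u ^ 2 * L ^ 7⌉₊) (J := J)
    (Φ := 4 * (1 + Real.log ⌊Q⌋₊)) (by linarith) hρx hL1 hu1 hK0 hbig (by positivity)
    (hQfl.trans hQ) hMV (by positivity)
    (Real.le_sqrt_of_sq_le (by
      have : (u ^ 2 * L ^ 4 / 2) ^ 2 = V / 4 := by rw [hV]; ring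
      rw [this]
      linarith))
    (Nat.le_ceil _) (natCeil_le_two_mul hR1) (Nat.le_ceil _) (natCeil_le_two_mul hz1)
    (by positivity) hJL (by positivity) (by linarith)
  refine (sumMaxDelta_mul_le hf1 hg1 hMM).trans ?_
  have s1 := small f hf3
  have s2 := small g hg3
  calc _ ≤ K * (1 + (4 * D + 8)) * (x / u) + K * (1 + (4 * D + 8)) * (x / u) +
        (640 * K + 300000) * (x / u) := by linarith
    _ = _ := by ring
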